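/- Let $p\in(1,\infty)$ and let $L^p=L^p([0,1],\mathbb R)$ with norm $\|\cdot\|_{L^p}$. For $q\in L^p$ consider the Dirichlet problem \[ -y''+q(x)y=\lambda y\quad\text{on }(0,1),\qquad y(0)=y(1)=0, \] where solutions are functions $y\in C^1[0,1]$ with $y'$ absolutely continuous that satisfy the equation almost everywhere. Let $\lambda_1(q)<\lambda_2(q)<\cdots$ be its eigenvalues, let $E_m(\cdot;q)$ be an eigenfunction for $\lambda_m(q)$, and for $m\ge 2$ let $0<T_{1,m}(q)<T_{2,m}(q)<\cdots<T_{m-1,m}(q)<1$ be the zeros of $E_m(\cdot;q)$ in $(0,1)$ (the nodes). Fix integers $m\ge 2$ and $1\le i\le m-1$, a number $T_*\in(0,1)$ and a potential $q_0\in L^p$. Then there exists $\hat q\in L^p$ with $T_{i,m}(\hat q)=T_*$ such that \[ \|\hat q-q_0\|_{L^p}=\min\{\|q-q_0\|_{L^p} : q\in L^p,\ T_{i,m}(q)=T_*\}. \] -/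

import Mathlib

open MeasureTheory Set
open scoped ENNReal

noncomputable section

namespace SturmLiouville

/-- Lebesgue measure on the unit interval `[0, 1]`. -/
abbrev unitVolume : Measure ℝ := volume.restrict (Icc (0 : ℝ) 1)

/-- The real Lebesgue space `L^p([0,1], ℝ)`. -/
abbrev LpUnit (p : ℝ≥0∞) := Lp ℝ p unitVolume

/-- `y` is an eigenfunction, with eigenvalue `μ`, of the Dirichlet problem
`-y'' + q y = μ y` on `(0,1)`, `y(0) = y(1) = 0`, in the Carathéodory sense:
`y` is not identically zero on `[0,1]`, it is differentiable on `[0,1]`, its derivative `dy` is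
absolutely continuous on `[0,1]`, and the equation holds almost everywhere.
Values of `y` outside `[0,1]` play no role. -/
structure IsDirichletEigenfunction (q : ℝ → ℝ) (μ : ℝ) (y : ℝ → ℝ) : Prop where
  left_zero : y 0 = 0
  right_zero : y 1 = 0
  nontrivial : ∃ x ∈ Icc (0 : ℝ) 1, y x ≠ 0
  equation : ∃ dy : ℝ → ℝ,
    (∀ x ∈ Icc (0 : ℝ) 1, HasDerivWithinAt y (dy x) (Icc 0 1) x) ∧
    AbsolutelyContinuousOnInterval dy 0 1 ∧
    ∃ ddy : ℝ → ℝ, ∀ᵐ x ∂unitVolume,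
      HasDerivAt dy (ddy x) x ∧ -ddy x + q x * y x = μ * y x

/-- The set of (real) Dirichlet eigenvalues of the potential `q`. -/
def dirichletEigenvalues (q : ℝ → ℝ) : Set ℝ :=
  {μ | ∃ y, IsDirichletEigenfunction q μ y}

/-- `μ` is the `m`-th Dirichlet eigenvalue `λ_m(q)` (`m = 1, 2, …`): it is an eigenvalue and
exactly `m - 1` eigenvalues are smaller. -/
def IsNthEigenvalue (q : ℝ → ℝ) (m : ℕ) (μ : ℝ) : Prop :=
  μ ∈ dirichletEigenvalues q ∧ (dirichletEigenvalues q ∩ Iio μ).encard + 1 = (m : ℕ∞)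

/-- `T` is the `(i, m)`-th node `T_{i,m}(q)` (`i = 1, 2, …`): it is the `i`-th zero in `(0,1)`,
from the left, of an eigenfunction for the `m`-th Dirichlet eigenvalue of `q`; that is, it is such
a zero and exactly `i - 1` zeros lie in `(0, T)`. -/
def IsNode (q : ℝ → ℝ) (i m : ℕ) (T : ℝ) : Prop :=
  ∃ (μ : ℝ) (y : ℝ → ℝ), IsNthEigenvalue q m μ ∧ IsDirichletEigenfunction q μ y ∧
    T ∈ Ioo (0 : ℝ) 1 ∧ y T = 0 ∧ {x ∈ Ioo (0 : ℝ) T | y x = 0}.encard + 1 = (i : ℕ∞)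

/-- The admissible potentials of Problem (P): those `q ∈ L^p([0,1])` with `T_{i,m}(q) = T`. -/
def admissiblePotentials (p : ℝ≥0∞) (i m : ℕ) (T : ℝ) : Set (LpUnit p) :=
  {q | IsNode q i m T}

end SturmLiouville

end

noncomputable section

namespace SturmLiouville

open Filter Topology Real

/-! This is the direct method of the calculus of variations. Let `F` be the primitive of `q` and `v
= y' - F y` the quasi-derivative. Then `q` cancels: `y' = F y + v`, `v' = -(μ + F ^ 2) y - F v`, so
the eigenvalue problem depends on `q` only through the continuous function `F`. Writing `y = r sin
θ`, `v = r cos θ` gives a scalar equation for `θ`, and `T` is the `(i, m)`-th node exactly when some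
`μ` satisfies `θ 1 = m π` and `θ T = i π` (`isNode_iff`).

Since `p > 1`, an `L^p`-bounded sequence has a subsequence whose primitives converge uniformly to
the primitive of an `L^p` function, and norm bounds survive (`exists_tendstoUniformlyOn_primitive`).
This plays the role of weak compactness and weak lower semicontinuity. The angle is continuous in
`(F, μ)` for uniform convergence (`tendsto_isPruferAngle`), and a bound on `F` confines the `m`-th
eigenvalue to a compact interval, so the node condition passes to the limit
(`isNode_of_tendstoUniformlyOn`). A minimizing sequence exists because an explicit piecewise
constant potential is admissible (`admissiblePotentials_nonempty`). -/

/-! ### Comparison for scalar differential equations. -/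

theorem le_of_subsolution_supersolution {f : ℝ → ℝ → ℝ} {a b L : ℝ} {u v u' v' : ℝ → ℝ}
    (hL : ∀ x ∈ Icc a b, ∀ s t, |f x s - f x t| ≤ L * |s - t|)
    (hu : ∀ x ∈ Icc a b, HasDerivWithinAt u (u' x) (Icc a b) x)
    (hv : ∀ x ∈ Icc a b, HasDerivWithinAt v (v' x) (Icc a b) x)
    (hu' : ∀ x ∈ Icc a b, u' x ≤ f x (u x)) (hv' : ∀ x ∈ Icc a b, f x (v x) ≤ v' x)
    (h0 : u a ≤ v a) : ∀ x ∈ Icc a b, u x ≤ v x := by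
  -- The rate `L + 1` beats the Lipschitz constant, so the perturbed `v` has strictly larger slope
  -- than `u` wherever they touch.
  have key : ∀ ε > 0, ∀ x ∈ Icc a b, u x ≤ v x + ε * exp ((L + 1) * x) := by
    intro ε hε
    have hE : ∀ x, HasDerivAt (fun x => ε * exp ((L + 1) * x))
        (ε * (exp ((L + 1) * x) * (L + 1))) x := fun x =>
      (((hasDerivAt_id x).const_mul (L + 1)).exp.congr_deriv (by simp)).const_mul ε
    have hIci : ∀ x ∈ Ico a b, Icc a b ∈ 𝓝[Ici x] x := fun x hx =>
      mem_of_superset (Icc_mem_nhdsGE hx.2) (Icc_subset_Icc_left hx.1)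
    intro x hx
    refine image_le_of_deriv_right_lt_deriv_boundary' (f := u) (f' := u')
      (B := fun x => v x + ε * exp ((L + 1) * x))
      (B' := fun x => v' x + ε * (exp ((L + 1) * x) * (L + 1)))
      (fun x hx => (hu x hx).continuousWithinAt)
      (fun x hx => (hu x (Ico_subset_Icc_self hx)).mono_of_mem_nhdsWithin (hIci x hx)) ?_ ?_
      (fun x hx => ((hv x (Ico_subset_Icc_self hx)).mono_of_mem_nhdsWithin (hIci x hx)).add
        (hE x).hasDerivWithinAt) ?_ hx
    · have := exp_pos ((L + 1) * a)
      have := mul_pos hε this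
      linarith
    · exact fun x hx => ((hv x hx).add (hE x).hasDerivWithinAt).continuousWithinAt
    · intro x hx hxx
      have hx' := Ico_subset_Icc_self hx
      have hp : 0 < ε * exp ((L + 1) * x) := mul_pos hε (exp_pos _)
      have h1 := hL x hx' (u x) (v x)
      rw [hxx, add_sub_cancel_left, abs_of_pos hp, ← hxx] at h1
      have := le_abs_self (f x (u x) - f x (v x))
      have := hu' x hx'
      have := hv' x hx'
      nlinarith
  intro x hx
  refine le_of_forall_pos_le_add fun ε hε => ?_
  have := key (ε / exp ((L + 1) * x)) (by positivity) x hx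
  rwa [div_mul_cancel₀ _ (exp_pos _).ne'] at this

/-- By the Lipschitz bound `(v - u) exp (L x)` is nondecreasing; being nonnegative and zero at `b`,
it vanishes. This is what turns weak comparison into strict comparison below. -/
theorem eq_of_subsolution_supersolution {f : ℝ → ℝ → ℝ} {a b L : ℝ} {u v u' v' : ℝ → ℝ}
    (hL : ∀ x ∈ Icc a b, ∀ s t, |f x s - f x t| ≤ L * |s - t|)
    (hu : ∀ x ∈ Icc a b, HasDerivWithinAt u (u' x) (Icc a b) x)
    (hv : ∀ x ∈ Icc a b, HasDerivWithinAt v (v' x) (Icc a b) x)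
    (hu' : ∀ x ∈ Icc a b, u' x ≤ f x (u x)) (hv' : ∀ x ∈ Icc a b, f x (v x) ≤ v' x)
    (h0 : u a ≤ v a) (h1 : u b = v b) : ∀ x ∈ Icc a b, u x = v x := by
  have hle := le_of_subsolution_supersolution hL hu hv hu' hv' h0
  intro x hx
  have hE : ∀ x, HasDerivAt (fun x => exp (L * x)) (exp (L * x) * L) x := fun x =>
    ((hasDerivAt_id x).const_mul L).exp.congr_deriv (by simp)
  have hd : ∀ x ∈ Icc a b, HasDerivWithinAt (fun x => (v x - u x) * exp (L * x))
      ((v' x - u' x) * exp (L * x) + (v x - u x) * (exp (L * x) * L)) (Icc a b) x :=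
    fun x hx => ((hv x hx).sub (hu x hx)).mul (hE x).hasDerivWithinAt
  have hmono : MonotoneOn (fun x => (v x - u x) * exp (L * x)) (Icc a b) := by
    refine monotoneOn_of_hasDerivWithinAt_nonneg (convex_Icc a b)
      (fun x hx => (hd x hx).continuousWithinAt)
      (fun x hx => (hd x (interior_subset hx)).mono interior_subset) ?_
    intro x hx
    replace hx := interior_subset hx
    have h2 := hL x hx (u x) (v x)
    rw [abs_of_nonpos (sub_nonpos.2 (hle x hx))] at h2
    have := le_abs_self (f x (u x) - f x (v x))
    have := hu' x hx
    have := hv' x hx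
    have : 0 ≤ (v' x - u' x) + (v x - u x) * L := by nlinarith
    nlinarith [exp_pos (L * x), mul_nonneg this (exp_pos (L * x)).le]
  have := hmono hx ⟨hx.1.trans hx.2, le_rfl⟩ hx.2
  simp only [h1, sub_self, zero_mul] at this
  have := nonpos_of_mul_nonpos_left this (exp_pos _)
  linarith [hle x hx]

/-! ### The Prüfer angle: existence, monotonicity, continuous dependence. -/

/-- The right-hand side of the Prüfer equation of the system `y' = F y + v`,
`v' = -(μ + F ^ 2) y - F v`. -/
def pruferField (F : ℝ → ℝ) (μ x θ : ℝ) : ℝ := (F x * sin θ + cos θ) ^ 2 + μ * sin θ ^ 2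

/-- `θ` is the Prüfer angle starting at `0`. -/
def IsPruferAngle (F : ℝ → ℝ) (μ : ℝ) (θ : ℝ → ℝ) : Prop :=
  θ 0 = 0 ∧ ∀ x ∈ Icc (0 : ℝ) 1, HasDerivWithinAt θ (pruferField F μ x (θ x)) (Icc 0 1) x

theorem IsPruferAngle.continuousOn {F : ℝ → ℝ} {μ : ℝ} {θ : ℝ → ℝ} (h : IsPruferAngle F μ θ) :
    ContinuousOn θ (Icc 0 1) := fun x hx => (h.2 x hx).continuousWithinAt

theorem abs_pruferField_sub_le {F : ℝ → ℝ} {M x : ℝ} (μ : ℝ) (hM : |F x| ≤ M) (s t : ℝ) :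
    |pruferField F μ x s - pruferField F μ x t| ≤ (2 * (M + 1) ^ 2 + 2 * |μ|) * |s - t| := by
  have hM0 : 0 ≤ M := (abs_nonneg _).trans hM
  have h1 := abs_sin_sub_sin_le s t
  have h2 := abs_cos_sub_cos_le s t
  have hA : |(F x * sin s + cos s) - (F x * sin t + cos t)| ≤ (M + 1) * |s - t| := by
    calc _ = |F x * (sin s - sin t) + (cos s - cos t)| := by ring_nf
      _ ≤ |F x| * |sin s - sin t| + |cos s - cos t| := by
        rw [← abs_mul]; exact abs_add_le _ _
      _ ≤ M * |s - t| + |s - t| := by gcongr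
      _ = _ := by ring
  have hB : ∀ s, |F x * sin s + cos s| ≤ M + 1 := fun s => by
    calc _ ≤ |F x| * |sin s| + |cos s| := by rw [← abs_mul]; exact abs_add_le _ _
      _ ≤ M * 1 + 1 := by gcongr; exacts [abs_sin_le_one s, abs_cos_le_one s]
      _ = _ := by ring
  have hC : |(F x * sin s + cos s) + (F x * sin t + cos t)| ≤ 2 * (M + 1) :=
    (abs_add_le _ _).trans (by linarith [hB s, hB t])
  have hD : |sin s + sin t| ≤ 2 :=
    (abs_add_le _ _).trans (by linarith [abs_sin_le_one s, abs_sin_le_one t])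
  calc |pruferField F μ x s - pruferField F μ x t|
      = |((F x * sin s + cos s) + (F x * sin t + cos t)) *
          ((F x * sin s + cos s) - (F x * sin t + cos t)) +
          μ * ((sin s + sin t) * (sin s - sin t))| := by unfold pruferField; ring_nf
    _ ≤ 2 * (M + 1) * ((M + 1) * |s - t|) + |μ| * (2 * |s - t|) := by
        refine (abs_add_le _ _).trans ?_
        rw [abs_mul, abs_mul μ, abs_mul (sin s + sin t)]
        gcongr
    _ = _ := by ring

theorem abs_pruferField_le {F : ℝ → ℝ} {M x : ℝ} (μ : ℝ) (hM : |F x| ≤ M) (s : ℝ) :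
    |pruferField F μ x s| ≤ (M + 1) ^ 2 + |μ| := by
  have hB : |F x * sin s + cos s| ≤ M + 1 := by
    calc _ ≤ |F x| * |sin s| + |cos s| := by rw [← abs_mul]; exact abs_add_le _ _
      _ ≤ M * 1 + 1 := by
        gcongr; exacts [(abs_nonneg _).trans hM, abs_sin_le_one s, abs_cos_le_one s]
      _ = _ := by ring
  refine (abs_add_le _ _).trans ?_
  rw [abs_pow, abs_mul, abs_pow]
  have : |sin s| ^ 2 ≤ 1 := pow_le_one₀ (abs_nonneg _) (abs_sin_le_one s)
  have := mul_le_mul_of_nonneg_left this (abs_nonneg μ)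
  gcongr
  linarith

theorem exists_isPruferAngle {F : ℝ → ℝ} (hF : ContinuousOn F (Icc 0 1)) (μ : ℝ) :
    ∃ θ, IsPruferAngle F μ θ := by
  obtain ⟨M, hM⟩ := isCompact_Icc.exists_bound_of_continuousOn hF
  have h0 : (0 : ℝ) ∈ Icc (0 : ℝ) 1 := by simp
  -- The field is globally bounded, and the radius equals that bound times the length 1 of the
  -- interval, so a single application reaches all of `[0, 1]`.
  have hP : IsPicardLindelof (pruferField F μ) (⟨0, h0⟩ : Icc (0 : ℝ) 1) 0
      (((M + 1) ^ 2 + |μ|).toNNReal) 0 (((M + 1) ^ 2 + |μ|).toNNReal)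
      ((2 * (M + 1) ^ 2 + 2 * |μ|).toNNReal) := by
    refine ⟨fun t ht => LipschitzWith.lipschitzOnWith ?_, fun x _ => ?_, fun t ht x _ => ?_, ?_⟩
    · refine LipschitzWith.of_dist_le_mul fun s u => ?_
      rw [Real.coe_toNNReal _ (by positivity)]
      exact abs_pruferField_sub_le μ (hM t ht) s u
    · unfold pruferField
      fun_prop
    · rw [Real.coe_toNNReal _ (by positivity)]
      exact abs_pruferField_le μ (hM t ht) x
    · simp
  obtain ⟨θ, h1, h2⟩ := hP.exists_eq_forall_mem_Icc_hasDerivWithinAt₀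
  exact ⟨θ, h1, h2⟩

theorem pruferField_of_sin_eq_zero (F : ℝ → ℝ) (μ x : ℝ) {θ : ℝ} (h : sin θ = 0) :
    pruferField F μ x θ = 1 := by
  have := sin_sq_add_cos_sq θ
  rw [h] at this
  simp only [pruferField, h]
  linarith

/-- At multiples of `π` the field equals 1, so constants `k π` are subsolutions and the angle
crosses them only upwards. Equality at `t` would make `θ` constant on `[s, t]`, with slope both 0
and 1. -/
theorem IsPruferAngle.lt_of_le {F : ℝ → ℝ} {μ : ℝ} {θ : ℝ → ℝ} (hF : ContinuousOn F (Icc 0 1))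
    (h : IsPruferAngle F μ θ) (k : ℕ) {s t : ℝ} (hs : 0 ≤ s) (hst : s < t) (ht : t ≤ 1)
    (hk : k * π ≤ θ s) : k * π < θ t := by
  obtain ⟨M, hM⟩ := isCompact_Icc.exists_bound_of_continuousOn hF
  have hsub : Icc s t ⊆ Icc 0 1 := Icc_subset_Icc hs ht
  have hL : ∀ x ∈ Icc s t, ∀ a b, |pruferField F μ x a - pruferField F μ x b| ≤
    (2 * (M + 1) ^ 2 + 2 * |μ|) * |a - b| := fun x hx => abs_pruferField_sub_le μ (hM x (hsub hx))
  have hc : ∀ x ∈ Icc s t, HasDerivWithinAt (fun _ => k * π) 0 (Icc s t) x :=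
    fun x _ => hasDerivWithinAt_const _ _ _
  have hd : ∀ x ∈ Icc s t, HasDerivWithinAt θ (pruferField F μ x (θ x)) (Icc s t) x :=
    fun x hx => (h.2 x (hsub hx)).mono hsub
  have h1 : ∀ x ∈ Icc s t, (0 : ℝ) ≤ pruferField F μ x (k * π) := fun x _ => by
    rw [pruferField_of_sin_eq_zero F μ x (sin_nat_mul_pi k)]; exact zero_le_one
  have hle := le_of_subsolution_supersolution hL hc hd h1 (fun _ _ => le_rfl) hk t
    ⟨hst.le, le_rfl⟩
  refine hle.lt_of_ne fun heq => ?_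
  have hE := eq_of_subsolution_supersolution hL hc hd h1 (fun _ _ => le_rfl) hk heq
  have hs' : s ∈ Icc s t := ⟨le_rfl, hst.le⟩
  have h3 := (hc s hs').congr (fun x hx => (hE x hx).symm) (hE s hs').symm
  have h4 := (uniqueDiffOn_Icc hst s hs').eq_deriv _ h3 (hd s hs')
  rw [← hE s hs', pruferField_of_sin_eq_zero F μ s (sin_nat_mul_pi k)] at h4
  exact zero_ne_one h4

theorem IsPruferAngle.strictMono {F : ℝ → ℝ} {μ₁ μ₂ : ℝ} {θ₁ θ₂ : ℝ → ℝ}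
    (hF : ContinuousOn F (Icc 0 1)) (hμ : μ₁ < μ₂)
    (h₁ : IsPruferAngle F μ₁ θ₁) (h₂ : IsPruferAngle F μ₂ θ₂) : θ₁ 1 < θ₂ 1 := by
  obtain ⟨M, hM⟩ := isCompact_Icc.exists_bound_of_continuousOn hF
  have hL : ∀ x ∈ Icc (0 : ℝ) 1, ∀ a b, |pruferField F μ₁ x a - pruferField F μ₁ x b| ≤
    (2 * (M + 1) ^ 2 + 2 * |μ₁|) * |a - b| := fun x hx => abs_pruferField_sub_le μ₁ (hM x hx)
  have hs : ∀ x ∈ Icc (0 : ℝ) 1, pruferField F μ₁ x (θ₂ x) ≤ pruferField F μ₂ x (θ₂ x) :=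
    fun x _ => by unfold pruferField; gcongr
  have h0 : θ₁ 0 ≤ θ₂ 0 := by rw [h₁.1, h₂.1]
  have h1m : (1 : ℝ) ∈ Icc (0 : ℝ) 1 := by simp
  refine (le_of_subsolution_supersolution hL h₁.2 h₂.2 (fun _ _ => le_rfl) hs h0 1 h1m).lt_of_ne
    fun heq => ?_
  have hE := eq_of_subsolution_supersolution hL h₁.2 h₂.2 (fun _ _ => le_rfl) hs h0 heq
  -- If the angles agree, so do their slopes, which forces `sin θ₂ = 0`; then `θ₂` has slope 1 and
  -- is the identity, although `sin 1 ≠ 0`.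
  have hsin : ∀ x ∈ Icc (0 : ℝ) 1, sin (θ₂ x) = 0 := fun x hx => by
    have h4 := (uniqueDiffOn_Icc zero_lt_one x hx).eq_deriv _
      ((h₁.2 x hx).congr (fun y hy => (hE y hy).symm) (hE x hx).symm) (h₂.2 x hx)
    rw [hE x hx] at h4
    unfold pruferField at h4
    have : (μ₂ - μ₁) * sin (θ₂ x) ^ 2 = 0 := by linarith
    simpa [sub_ne_zero.2 hμ.ne'] using this
  have hid : ∀ x ∈ Icc (0 : ℝ) 1, θ₂ x = x := by
    refine eq_of_has_deriv_right_eq (f' := fun _ => 1) (fun x hx => ?_)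
      (fun x hx => (hasDerivAt_id x).hasDerivWithinAt) h₂.continuousOn continuousOn_id h₂.1
    have h5 := h₂.2 x (Ico_subset_Icc_self hx)
    rw [pruferField_of_sin_eq_zero F μ₂ x (hsin x (Ico_subset_Icc_self hx))] at h5
    exact h5.mono_of_mem_nhdsWithin
      (mem_of_superset (Icc_mem_nhdsGE hx.2) (Icc_subset_Icc_left hx.1))
  have := hsin 1 h1m
  rw [hid 1 h1m] at this
  exact (sin_pos_of_pos_of_lt_pi one_pos (by linarith [pi_gt_three])).ne' this

theorem tendsto_isPruferAngle {Fn : ℕ → ℝ → ℝ} {F : ℝ → ℝ} {μn : ℕ → ℝ} {μ : ℝ}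
    {θn : ℕ → ℝ → ℝ} {θ : ℝ → ℝ} (hF : ContinuousOn F (Icc 0 1))
    (hFn : TendstoUniformlyOn Fn F atTop (Icc 0 1)) (hμ : Tendsto μn atTop (𝓝 μ))
    (hθn : ∀ n, IsPruferAngle (Fn n) (μn n) (θn n)) (hθ : IsPruferAngle F μ θ)
    {x : ℝ} (hx : x ∈ Icc (0 : ℝ) 1) : Tendsto (fun n => θn n x) atTop (𝓝 (θ x)) := by
  obtain ⟨M, hM⟩ := isCompact_Icc.exists_bound_of_continuousOn hF
  have hM0 : 0 ≤ M := (norm_nonneg _).trans (hM 0 (by simp))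
  set K : NNReal := (2 * (M + 1) ^ 2 + 2 * |μ|).toNNReal with hK
  -- The fields differ by at most `(2 M + 4) η` once `F` and `μ` are `η`-close with `η < 1`;
  -- Grönwall's inequality does the rest.
  have hg : Tendsto (fun η => gronwallBound 0 K ((2 * M + 4) * η + 0) (x - 0)) (𝓝[>] 0) (𝓝 0) := by
    have h1 : Continuous fun η => gronwallBound 0 K ((2 * M + 4) * η + 0) (x - 0) :=
      (gronwallBound_continuous_ε 0 K (x - 0)).comp (by fun_prop)
    have h2 := h1.tendsto 0
    simp only [mul_zero, add_zero, gronwallBound_ε0_δ0] at h2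
    exact (by simpa using h2 : Tendsto _ _ _).mono_left nhdsWithin_le_nhds
  rw [Metric.tendsto_atTop']
  intro ε hε
  obtain ⟨η, hη, hη0, hη1⟩ := ((hg.eventually (gt_mem_nhds hε)).and
    (Ioo_mem_nhdsGT (zero_lt_one' ℝ))).exists
  obtain ⟨N, hN⟩ := eventually_atTop.1 ((Metric.tendstoUniformlyOn_iff.1 hFn η hη0).and
    (Metric.tendsto_nhds.1 hμ η hη0))
  refine ⟨N, fun n hn => lt_of_le_of_lt ?_ hη⟩
  obtain ⟨h1, h2⟩ := hN n hn.le
  have hIci : ∀ x ∈ Ico (0 : ℝ) 1, Icc (0 : ℝ) 1 ∈ 𝓝[Ici x] x := fun x hx =>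
      mem_of_superset (Icc_mem_nhdsGE hx.2) (Icc_subset_Icc_left hx.1)
  refine dist_le_of_approx_trajectories_ODE_of_mem (v := pruferField F μ) (s := fun _ => univ)
    (a := 0) (b := 1)
    (f' := fun t => pruferField (Fn n) (μn n) t (θn n t)) (g' := fun t => pruferField F μ t (θ t))
    (fun t ht => LipschitzWith.lipschitzOnWith (LipschitzWith.of_dist_le_mul fun s u => ?_))
    (hθn n).continuousOn
    (fun t ht => ((hθn n).2 t (Ico_subset_Icc_self ht)).mono_of_mem_nhdsWithin (hIci t ht))
    (fun t ht => ?_) (fun _ _ => trivial) hθ.continuousOn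
    (fun t ht => (hθ.2 t (Ico_subset_Icc_self ht)).mono_of_mem_nhdsWithin (hIci t ht))
    (fun t ht => (dist_self _).le) (fun _ _ => trivial) ?_ x hx
  · rw [hK, Real.coe_toNNReal _ (by positivity)]
    exact abs_pruferField_sub_le μ (hM t (Ico_subset_Icc_self ht)) s u
  · have h3 := h1 t (Ico_subset_Icc_self ht)
    have h4 := hM t (Ico_subset_Icc_self ht)
    rw [Real.norm_eq_abs] at h4
    rw [dist_comm, Real.dist_eq] at h3
    rw [Real.dist_eq] at h2
    generalize θn n t = s
    have h5 : |Fn n t + F t| ≤ 2 * M + 1 := by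
      calc _ = |(Fn n t - F t) + (F t + F t)| := by ring_nf
        _ ≤ |Fn n t - F t| + (|F t| + |F t|) :=
          (abs_add_le _ _).trans (by gcongr; exact abs_add_le _ _)
        _ ≤ _ := by linarith
    have hs1 := abs_sin_le_one s
    have hc1 := abs_cos_le_one s
    rw [Real.dist_eq]
    calc |pruferField (Fn n) (μn n) t s - pruferField F μ t s|
        = |(Fn n t - F t) * ((Fn n t + F t) * sin s + 2 * cos s) * sin s
            + (μn n - μ) * sin s ^ 2| := by
          unfold pruferField; ring_nf
      _ ≤ |Fn n t - F t| * (|Fn n t + F t| * |sin s| + 2 * |cos s|) * |sin s|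
            + |μn n - μ| * |sin s| ^ 2 := by
          refine (abs_add_le _ _).trans ?_
          rw [abs_mul, abs_mul, abs_mul, abs_pow]
          gcongr
          refine (abs_add_le _ _).trans ?_
          rw [abs_mul, abs_mul, abs_two]
      _ ≤ η * ((2 * M + 1) * 1 + 2 * 1) * 1 + η * 1 ^ 2 := by gcongr
      _ = _ := by ring
  · rw [hθ.1, (hθn n).1, dist_self]

/-! ### Bounds on the spectral parameter, uniform in `F`. -/

/-- The line from `π / 4` to `3 π / 4` is a supersolution: along it `cos ^ 2 ≤ 1 / 2`, and `(F sin +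
cos) ^ 2 ≤ 2 F ^ 2 sin ^ 2 + 2 cos ^ 2` makes the field negative. -/
theorem IsPruferAngle.lt_pi {F : ℝ → ℝ} {M μ : ℝ} {θ : ℝ → ℝ}
    (hM : ∀ x ∈ Icc (0 : ℝ) 1, |F x| ≤ M) (h : IsPruferAngle F μ θ)
    (hμ : μ ≤ -(2 * M ^ 2 + 3)) : θ 1 < π := by
  have hL : ∀ x ∈ Icc (0 : ℝ) 1, ∀ a b, |pruferField F μ x a - pruferField F μ x b| ≤
    (2 * (M + 1) ^ 2 + 2 * |μ|) * |a - b| := fun x hx => abs_pruferField_sub_le μ (hM x hx)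
  have hv : ∀ x ∈ Icc (0 : ℝ) 1, HasDerivWithinAt (fun x => π / 4 + π / 2 * x) (π / 2)
      (Icc 0 1) x := fun x _ =>
    ((((hasDerivAt_id x).const_mul (π / 2)).const_add (π / 4)).congr_deriv
      (by simp)).hasDerivWithinAt
  have := le_of_subsolution_supersolution hL h.2 hv (fun _ _ => le_rfl) ?_
    (by rw [h.1]; positivity) 1 (by simp)
  · linarith [pi_pos]
  intro x hx
  set w := π / 4 + π / 2 * x with hw
  have hpi := pi_gt_three
  have hcos : cos w ^ 2 ≤ 1 / 2 := by
    have h2 : cos (2 * w) ≤ 0 := by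
      apply cos_nonpos_of_pi_div_two_le_of_le <;> rw [hw] <;> nlinarith [hx.1, hx.2]
    rw [cos_two_mul] at h2
    linarith
  have hsc := sin_sq_add_cos_sq w
  have hF2 : F x ^ 2 ≤ M ^ 2 := by
    rw [← sq_abs (F x)]
    exact pow_le_pow_left₀ (abs_nonneg _) (hM x hx) 2
  unfold pruferField
  nlinarith [sq_nonneg (F x * sin w - cos w), mul_le_mul_of_nonneg_right hF2 (sq_nonneg (sin w)),
    mul_le_mul_of_nonneg_right hμ (sq_nonneg (sin w))]

theorem tendsto_integral_inv_cos_sq_add (b : ℝ) :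
    Tendsto (fun K : ℝ => ∫ s in (0 : ℝ)..b, 2 / (cos s ^ 2 + K * sin s ^ 2)) atTop (𝓝 0) := by
  suffices h : Tendsto (fun K : ℝ => ∫ s in (0 : ℝ)..b, 2 / (cos s ^ 2 + K * sin s ^ 2)) atTop
      (𝓝 (∫ _ in (0 : ℝ)..b, (0 : ℝ))) by simpa using h
  have hpos : ∀ K : ℝ, 1 ≤ K → ∀ s, 1 ≤ cos s ^ 2 + K * sin s ^ 2 := fun K hK s => by
    nlinarith [sin_sq_add_cos_sq s, mul_le_mul_of_nonneg_right hK (sq_nonneg (sin s))]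
  refine intervalIntegral.tendsto_integral_filter_of_dominated_convergence (μ := volume)
    (fun _ => 2)
    ?_ ?_ intervalIntegrable_const ?_
  · filter_upwards with K
    exact (by fun_prop : Measurable fun s : ℝ => 2 / (cos s ^ 2 + K * sin s ^ 2)).aestronglyMeasurable
  · filter_upwards [eventually_ge_atTop 1] with K hK
    filter_upwards with s _
    rw [Real.norm_eq_abs, abs_div, abs_two, abs_of_pos (by linarith [hpos K hK s])]
    exact div_le_self zero_le_two (hpos K hK s)
  · have hc : {s : ℝ | sin s = 0}.Countable := by
      have : {s : ℝ | sin s = 0} = range fun n : ℤ => n * π := by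
        ext s; exact sin_eq_zero_iff
      rw [this]; exact countable_range _
    filter_upwards [hc.ae_notMem volume] with s hs _
    have : 0 < sin s ^ 2 := by have : sin s ≠ 0 := hs; positivity
    exact Tendsto.const_div_atTop
      (tendsto_atTop_add_const_left _ _ (tendsto_id.atTop_mul_const this)) 2

/-- From `(F sin + cos) ^ 2 ≥ cos ^ 2 / 2 - F ^ 2 sin ^ 2` the field is at least `(cos ^ 2 + k sin ^
2) / 2` with `k = 2 (μ - M ^ 2)`. For large `k` this drives the angle past `b` in less than unit
time. -/
theorem exists_bound_of_isPruferAngle_le (M b : ℝ) :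
    ∃ K, ∀ (F : ℝ → ℝ) (μ : ℝ) (θ : ℝ → ℝ), (∀ x ∈ Icc (0 : ℝ) 1, |F x| ≤ M) →
      IsPruferAngle F μ θ → θ 1 ≤ b → μ ≤ K := by
  obtain ⟨K, hK'⟩ := eventually_atTop.1 ((eventually_ge_atTop (1 : ℝ)).and
    ((tendsto_integral_inv_cos_sq_add b).eventually (gt_mem_nhds one_pos)))
  have hK1 : 1 ≤ K := (hK' K le_rfl).1
  refine ⟨K + M ^ 2, fun F μ θ hF h hb => ?_⟩
  by_contra! hμ
  set k := 2 * (μ - M ^ 2) with hk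
  have hkK : K ≤ k := by linarith
  have hpos : ∀ s, 0 < cos s ^ 2 + k * sin s ^ 2 := fun s => by
    nlinarith [sin_sq_add_cos_sq s,
      mul_le_mul_of_nonneg_right (hK1.trans hkK) (sq_nonneg (sin s))]
  have hcont : Continuous fun s => 2 / (cos s ^ 2 + k * sin s ^ 2) :=
    continuous_const.div (by fun_prop) fun s => (hpos s).ne'
  -- `H t` is the time the comparison equation needs to climb from 0 to `t`, so `H ∘ θ` grows at
  -- rate at least 1.
  set H : ℝ → ℝ := fun t => ∫ s in (0 : ℝ)..t, 2 / (cos s ^ 2 + k * sin s ^ 2) with hH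
  have hHd : ∀ t, HasDerivAt H (2 / (cos t ^ 2 + k * sin t ^ 2)) t := fun t =>
    hcont.integral_hasStrictDerivAt 0 t |>.hasDerivAt
  have hd : ∀ x ∈ Icc (0 : ℝ) 1, HasDerivWithinAt (fun x => H (θ x))
      (2 / (cos (θ x) ^ 2 + k * sin (θ x) ^ 2) * pruferField F μ x (θ x)) (Icc 0 1) x :=
    fun x hx => (hHd (θ x)).comp_hasDerivWithinAt x (h.2 x hx)
  have hIci : ∀ x ∈ Ico (0 : ℝ) 1, Icc (0 : ℝ) 1 ∈ 𝓝[Ici x] x := fun x hx =>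
      mem_of_superset (Icc_mem_nhdsGE hx.2) (Icc_subset_Icc_left hx.1)
  have h1 : (1 : ℝ) ≤ H (θ 1) := by
    refine image_le_of_deriv_right_le_deriv_boundary (f := id) (f' := fun _ => 1)
      (B := fun x => H (θ x)) continuousOn_id
      (fun x hx => (hasDerivAt_id x).hasDerivWithinAt) (by simp [h.1, hH])
      (fun x hx => (hd x hx).continuousWithinAt)
      (fun x hx => (hd x (Ico_subset_Icc_self hx)).mono_of_mem_nhdsWithin (hIci x hx)) ?_
      (right_mem_Icc.2 zero_le_one)
    intro x hx
    rw [div_mul_eq_mul_div, le_div_iff₀ (hpos _)]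
    have hF2 : F x ^ 2 ≤ M ^ 2 := by
      rw [← sq_abs (F x)]
      exact pow_le_pow_left₀ (abs_nonneg _) (hF x (Ico_subset_Icc_self hx)) 2
    unfold pruferField
    nlinarith [sq_nonneg (2 * F x * sin (θ x) + cos (θ x)),
      mul_le_mul_of_nonneg_right hF2 (sq_nonneg (sin (θ x)))]
  have hmono : Monotone H := monotone_of_hasDerivAt_nonneg hHd fun t =>
    (div_pos two_pos (hpos t)).le
  linarith [hmono hb, (hK' k hkK).2]

/-! ### Counting crossings of multiples of `π`. -/

/-- Each level `k π` with `0 < k < n` is hit exactly once: at least once by continuity, at most once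
by one-way crossing. It serves twice, counting zeros in `x` and eigenvalues in `μ`. -/
theorem encard_crossings {g : ℝ → ℝ} {a b : ℝ} {n : ℕ} (hab : a < b)
    (hg : ContinuousOn g (Icc a b))
    (hcross : ∀ k : ℕ, ∀ s ∈ Icc a b, ∀ t ∈ Icc a b, s < t → k * π ≤ g s → k * π < g t)
    (ha0 : 0 ≤ g a) (haπ : g a < π) (hb : g b = n * π) :
    {x ∈ Ioo a b | sin (g x) = 0}.encard + 1 = (n : ℕ∞) := by
  have ha' : a ∈ Icc a b := left_mem_Icc.2 hab.le
  have hb' : b ∈ Icc a b := right_mem_Icc.2 hab.le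
  have hlt : ∀ {k : ℕ} {l : ℕ}, (k : ℝ) * π < l * π → k < l := fun h =>
    by exact_mod_cast lt_of_mul_lt_mul_right h pi_pos.le
  have hn : 0 < n := by
    have := hcross 0 a ha' b hb' hab (by simpa using ha0)
    rw [hb] at this
    exact hlt this
  have hpos : ∀ x ∈ Ioo a b, 0 < g x := fun x hx => by
    simpa using hcross 0 a ha' x (Ioo_subset_Icc_self hx) hx.1 (by simpa using ha0)
  have hnat : ∀ x ∈ Ioo a b, sin (g x) = 0 → ∃ k : ℕ, 0 < k ∧ g x = k * π := fun x hx h => by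
    obtain ⟨k, hk⟩ := sin_eq_zero_iff.1 h
    have hk0 : (0 : ℝ) < k := by
      have := hpos x hx
      rw [← hk] at this
      exact pos_of_mul_pos_left this pi_pos.le
    lift k to ℕ using by exact_mod_cast hk0.le
    exact ⟨k, by exact_mod_cast hk0, by rw [← hk]; simp⟩
  have hinj : InjOn g {x ∈ Ioo a b | sin (g x) = 0} := by
    have hne : ∀ x ∈ Ioo a b, ∀ y ∈ Ioo a b, sin (g x) = 0 → x < y → g x ≠ g y := by
      intro x hx y hy h hxy he
      obtain ⟨k, -, hk⟩ := hnat x hx h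
      have := hcross k x (Ioo_subset_Icc_self hx) y (Ioo_subset_Icc_self hy) hxy hk.ge
      rw [← he, hk] at this
      exact lt_irrefl _ this
    intro x hx y hy he
    rcases lt_trichotomy x y with h | h | h
    · exact absurd he (hne x hx.1 y hy.1 hx.2 h)
    · exact h
    · exact absurd he.symm (hne y hy.1 x hx.1 hy.2 h)
  have himg : g '' {x ∈ Ioo a b | sin (g x) = 0} =
      (fun k : ℕ => (k : ℝ) * π) '' (Finset.Ioo 0 n : Finset ℕ) := by
    ext z
    constructor
    · rintro ⟨x, ⟨hx, h⟩, rfl⟩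
      obtain ⟨k, hk0, hk⟩ := hnat x hx h
      refine ⟨k, ?_, hk.symm⟩
      have hkn : k < n := by
        by_contra! hnk
        have := hcross n x (Ioo_subset_Icc_self hx) b hb' hx.2
          (by rw [hk]; gcongr)
        exact this.ne' hb
      simp [hk0, hkn]
    · rintro ⟨k, hk, rfl⟩
      simp only [Finset.coe_Ioo, mem_Ioo] at hk
      have h1 : (1 : ℝ) ≤ k := by exact_mod_cast hk.1
      have h2 : (k : ℝ) < n := by exact_mod_cast hk.2
      have : (k : ℝ) * π ∈ Ioo (g a) (g b) :=
        ⟨haπ.trans_le (by nlinarith [pi_pos]), by rw [hb]; gcongr⟩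
      obtain ⟨x, hx, hxe⟩ := intermediate_value_Ioo hab.le hg this
      exact ⟨x, ⟨hx, by rw [hxe, sin_nat_mul_pi]⟩, hxe⟩
  have hinj' : Function.Injective (fun k : ℕ => (k : ℝ) * π) := fun k l h => by
    simpa [pi_ne_zero] using h
  rw [← hinj.encard_image, himg, hinj'.encard_image, encard_coe_eq_coe_finsetCard, Nat.card_Ioo]
  norm_cast
  omega

theorem IsPruferAngle.encard_zeros {F : ℝ → ℝ} {μ : ℝ} {θ : ℝ → ℝ}
    (hF : ContinuousOn F (Icc 0 1)) (h : IsPruferAngle F μ θ) {x : ℝ} (hx : x ∈ Ioc (0 : ℝ) 1)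
    {n : ℕ} (hn : θ x = n * π) : {t ∈ Ioo 0 x | sin (θ t) = 0}.encard + 1 = (n : ℕ∞) :=
  encard_crossings hx.1 (h.continuousOn.mono (Icc_subset_Icc_right hx.2))
    (fun k _ hs _ ht hst => h.lt_of_le hF k hs.1 hst (ht.2.trans hx.2)) h.1.ge
    (h.1.trans_lt pi_pos) hn

theorem IsPruferAngle.exists_nat {F : ℝ → ℝ} {μ : ℝ} {θ : ℝ → ℝ}
    (hF : ContinuousOn F (Icc 0 1)) (h : IsPruferAngle F μ θ) {x : ℝ} (hx : x ∈ Ioc (0 : ℝ) 1)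
    (hs : sin (θ x) = 0) : ∃ n : ℕ, θ x = n * π := by
  obtain ⟨k, hk⟩ := sin_eq_zero_iff.1 hs
  have hk0 : (0 : ℝ) < k := by
    have := h.lt_of_le hF 0 le_rfl hx.1 hx.2 (by simp [h.1])
    rw [← hk, Nat.cast_zero, zero_mul] at this
    exact pos_of_mul_pos_left this pi_pos.le
  lift k to ℕ using by exact_mod_cast hk0.le
  exact ⟨k, by rw [← hk]; simp⟩

/-! ### The quasi-derivative system and its link to eigenfunctions. -/

/-- The linear system for `y` and its quasi-derivative `v = y' - F y`. -/
def IsSystemSolution (F : ℝ → ℝ) (μ : ℝ) (y v : ℝ → ℝ) : Prop :=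
  ∀ x ∈ Icc (0 : ℝ) 1, HasDerivWithinAt y (F x * y x + v x) (Icc 0 1) x ∧
    HasDerivWithinAt v (-(μ + F x ^ 2) * y x - F x * v x) (Icc 0 1) x

theorem IsSystemSolution.eq_zero {F : ℝ → ℝ} {μ : ℝ} {y v : ℝ → ℝ}
    (hF : ContinuousOn F (Icc 0 1)) (h : IsSystemSolution F μ y v) (hy : y 0 = 0) (hv : v 0 = 0) :
    ∀ x ∈ Icc (0 : ℝ) 1, y x = 0 := by
  obtain ⟨M, hM⟩ := isCompact_Icc.exists_bound_of_continuousOn hF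
  have hIci : ∀ x ∈ Ico (0 : ℝ) 1, Icc (0 : ℝ) 1 ∈ 𝓝[Ici x] x := fun x hx =>
      mem_of_superset (Icc_mem_nhdsGE hx.2) (Icc_subset_Icc_left hx.1)
  have hd : ∀ x ∈ Icc (0 : ℝ) 1, HasDerivWithinAt (fun x => (y x, v x))
    (F x * y x + v x, -(μ + F x ^ 2) * y x - F x * v x) (Icc 0 1) x :=
    fun x hx => (h x hx).1.prodMk (h x hx).2
  have hz := eq_zero_of_abs_deriv_le_mul_abs_self_of_eq_zero_right
    (K := (M + 1) + ((|μ| + M ^ 2) + M)) (fun x hx => (hd x hx).continuousWithinAt)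
    (fun x hx => (hd x (Ico_subset_Icc_self hx)).mono_of_mem_nhdsWithin (hIci x hx))
    (by simp [hy, hv]) ?_
  · exact fun x hx => congrArg Prod.fst (hz x hx)
  intro x hx
  have hMx := hM x (Ico_subset_Icc_self hx)
  rw [Real.norm_eq_abs] at hMx
  have hM0 := (abs_nonneg _).trans hMx
  set N := ‖(y x, v x)‖ with hN
  have hN0 : 0 ≤ N := norm_nonneg _
  have hyN : |y x| ≤ N := norm_fst_le (y x, v x)
  have hvN : |v x| ≤ N := norm_snd_le (y x, v x)
  have h1 : |F x * y x + v x| ≤ (M + 1) * N := by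
    refine (abs_add_le _ _).trans ?_
    rw [abs_mul, add_mul, one_mul]
    gcongr
  have h2 : |-(μ + F x ^ 2) * y x - F x * v x| ≤ ((|μ| + M ^ 2) + M) * N := by
    refine (abs_sub _ _).trans ?_
    rw [abs_mul, abs_mul, abs_neg, add_mul]
    have : |μ + F x ^ 2| ≤ |μ| + M ^ 2 := by
      refine (abs_add_le _ _).trans ?_
      rw [abs_pow]
      gcongr
    gcongr
  have h3 : 0 ≤ (M + 1) * N := by positivity
  have h4 : 0 ≤ ((|μ| + M ^ 2) + M) * N := by positivity
  rw [Prod.norm_def, add_mul]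
  exact max_le (h1.trans (by linarith)) (h2.trans (by linarith))

theorem IsSystemSolution.continuousOn {F : ℝ → ℝ} {μ : ℝ} {y v : ℝ → ℝ}
    (h : IsSystemSolution F μ y v) : ContinuousOn y (Icc 0 1) ∧ ContinuousOn v (Icc 0 1) :=
  ⟨fun x hx => (h x hx).1.continuousWithinAt, fun x hx => (h x hx).2.continuousWithinAt⟩

theorem exists_antideriv {g : ℝ → ℝ} (hg : ContinuousOn g (Icc 0 1)) :
    ∃ G : ℝ → ℝ, G 0 = 0 ∧ ∀ x ∈ Icc (0 : ℝ) 1, HasDerivWithinAt G (g x) (Icc 0 1) x := by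
  set g' : ℝ → ℝ := IccExtend (zero_le_one' ℝ) ((Icc 0 1).domRestrict g) with hg'
  have hc : Continuous g' := (continuousOn_iff_continuous_domRestrict.1 hg).Icc_extend'
  refine ⟨fun x => ∫ t in (0 : ℝ)..x, g' t, by simp, fun x hx => ?_⟩
  have := (hc.integral_hasStrictDerivAt 0 x).hasDerivAt.hasDerivWithinAt (s := Icc 0 1)
  rwa [hg', IccExtend_of_mem _ _ hx] at this

theorem IsPruferAngle.exists_solution {F : ℝ → ℝ} {μ : ℝ} {θ : ℝ → ℝ}
    (hF : ContinuousOn F (Icc 0 1)) (h : IsPruferAngle F μ θ) :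
    ∃ r : ℝ → ℝ, r 0 = 1 ∧ (∀ x, 0 < r x) ∧
      IsSystemSolution F μ (fun x => r x * sin (θ x)) (fun x => r x * cos (θ x)) := by
  have hθ := h.continuousOn
  -- This is `r' / r`, computed from `r r' = y y' + v v'`.
  have hg : ContinuousOn (fun x => F x * (sin (θ x) ^ 2 - cos (θ x) ^ 2) +
      (1 - μ - F x ^ 2) * (sin (θ x) * cos (θ x))) (Icc 0 1) := by fun_prop
  obtain ⟨G, hG0, hG⟩ := exists_antideriv hg
  refine ⟨fun x => exp (G x), by simp [hG0], fun x => exp_pos _, fun x hx => ⟨?_, ?_⟩⟩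
  · refine ((hG x hx).exp.mul (h.2 x hx).sin).congr_deriv ?_
    unfold pruferField
    linear_combination exp (G x) * (F x * sin (θ x) + cos (θ x)) * sin_sq_add_cos_sq (θ x)
  · refine ((hG x hx).exp.mul (h.2 x hx).cos).congr_deriv ?_
    unfold pruferField
    linear_combination exp (G x) * (-(μ + F x ^ 2) * sin (θ x) - F x * cos (θ x)) *
      sin_sq_add_cos_sq (θ x)

theorem absolutelyContinuousOnInterval_of_hasDerivWithinAt {g g' : ℝ → ℝ}
    (hg' : ContinuousOn g' (Icc 0 1))
    (hg : ∀ x ∈ Icc (0 : ℝ) 1, HasDerivWithinAt g (g' x) (Icc 0 1) x) :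
    AbsolutelyContinuousOnInterval g 0 1 := by
  obtain ⟨M, hM⟩ := isCompact_Icc.exists_bound_of_continuousOn hg'
  have := (convex_Icc (0 : ℝ) 1).lipschitzOnWith_of_nnnorm_hasDerivWithin_le (C := M.toNNReal) hg
    (fun x hx => by
      rw [← NNReal.coe_le_coe, coe_nnnorm]
      exact (hM x hx).trans (Real.le_coe_toNNReal M))
  rw [← uIcc_of_le (zero_le_one' ℝ)] at this
  exact this.absolutelyContinuousOnInterval

/-- The primitive, vanishing at `0`, of a function on `[0, 1]` extended by zero. -/
def primitive (q : ℝ → ℝ) (x : ℝ) : ℝ := ∫ t in (0 : ℝ)..x, (Icc (0 : ℝ) 1).indicator q t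

section primitive

variable {q : ℝ → ℝ}

theorem integrable_indicator_Icc (hq : Integrable q unitVolume) :
    Integrable ((Icc (0 : ℝ) 1).indicator q) :=
  (integrable_indicator_iff measurableSet_Icc).2 hq

theorem continuous_primitive (hq : Integrable q unitVolume) : Continuous (primitive q) :=
  intervalIntegral.continuous_primitive
    (fun _ _ => (integrable_indicator_Icc hq).intervalIntegrable) 0

theorem absolutelyContinuousOnInterval_primitive (hq : Integrable q unitVolume) :
    AbsolutelyContinuousOnInterval (primitive q) 0 1 :=
  (integrable_indicator_Icc hq).intervalIntegrable.absolutelyContinuousOnInterval_intervalIntegral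
    left_mem_uIcc

theorem ae_hasDerivAt_primitive (hq : Integrable q unitVolume) :
    ∀ᵐ x ∂unitVolume, HasDerivAt (primitive q) (q x) x := by
  rw [ae_restrict_iff' measurableSet_Icc]
  filter_upwards [LocallyIntegrable.ae_hasDerivAt_integral
    (integrable_indicator_Icc hq).locallyIntegrable]
    with x hx hx01
  have := hx 0
  rwa [indicator_of_mem hx01] at this

end primitive

theorem ae_unitVolume_mem_Ioo : ∀ᵐ x ∂unitVolume, x ∈ Ioo (0 : ℝ) 1 := by
  have : unitVolume = volume.restrict (Ioo (0 : ℝ) 1) := (restrict_Ioo_eq_restrict_Icc).symm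
  rw [this]
  exact ae_restrict_mem measurableSet_Ioo

theorem IsSystemSolution.isDirichletEigenfunction {q : ℝ → ℝ} {μ : ℝ} {y v : ℝ → ℝ}
    (hq : Integrable q unitVolume) (h : IsSystemSolution (primitive q) μ y v) (h0 : y 0 = 0)
    (h1 : y 1 = 0) (hne : ∃ x ∈ Icc (0 : ℝ) 1, y x ≠ 0) : IsDirichletEigenfunction q μ y := by
  have hF := (continuous_primitive hq).continuousOn (s := Icc (0 : ℝ) 1)
  obtain ⟨hyc, hvc⟩ := h.continuousOn
  refine ⟨h0, h1, hne, fun x => primitive q x * y x + v x, fun x hx => (h x hx).1, ?_,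
    fun x => q x * y x - μ * y x, ?_⟩
  · refine ((absolutelyContinuousOnInterval_primitive hq).fun_mul
      (absolutelyContinuousOnInterval_of_hasDerivWithinAt ?_ fun x hx => (h x hx).1)).fun_add
      (absolutelyContinuousOnInterval_of_hasDerivWithinAt ?_ fun x hx => (h x hx).2)
    · fun_prop
    · fun_prop
  · filter_upwards [ae_hasDerivAt_primitive hq, ae_unitVolume_mem_Ioo] with x hx hx01
    have hn : Icc (0 : ℝ) 1 ∈ 𝓝 x := Icc_mem_nhds hx01.1 hx01.2
    obtain ⟨hy, hv⟩ := h x (Ioo_subset_Icc_self hx01)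
    refine ⟨((hx.mul (hy.hasDerivAt hn)).add (hv.hasDerivAt hn)).congr_deriv ?_, ?_⟩ <;> ring

/-- Almost everywhere `(y' - F y)' = -μ y - F y'`, a continuous function. By absolute continuity,
`y' - F y` differs from an antiderivative `V` of it by a constant, so the equation holds at every
point. -/
theorem IsDirichletEigenfunction.exists_isSystemSolution {q : ℝ → ℝ} {μ : ℝ} {y : ℝ → ℝ}
    (hq : Integrable q unitVolume) (h : IsDirichletEigenfunction q μ y) :
    ∃ v, IsSystemSolution (primitive q) μ y v := by
  obtain ⟨dy, hdy, hac, ddy, hae⟩ := h.equation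
  have hF := (continuous_primitive hq).continuousOn (s := Icc (0 : ℝ) 1)
  have hyc : ContinuousOn y (Icc 0 1) := fun x hx => (hdy x hx).continuousWithinAt
  have hdyc : ContinuousOn dy (Icc 0 1) := by
    have := hac.continuousOn
    rwa [uIcc_of_le (zero_le_one' ℝ)] at this
  have hwc : ContinuousOn (fun x => -(μ * y x) - primitive q x * dy x) (Icc 0 1) := by fun_prop
  obtain ⟨V, -, hV⟩ := exists_antideriv hwc
  have hvac : AbsolutelyContinuousOnInterval (fun x => dy x - primitive q x * y x - V x) 0 1 :=
    (hac.fun_sub ((absolutelyContinuousOnInterval_primitive hq).fun_mul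
      (absolutelyContinuousOnInterval_of_hasDerivWithinAt hdyc hdy))).fun_sub
      (absolutelyContinuousOnInterval_of_hasDerivWithinAt hwc hV)
  obtain ⟨C, hC⟩ := hvac.const_of_ae_hasDerivAt_zero <| by
    rw [uIcc_of_le (zero_le_one' ℝ), ← ae_restrict_iff' measurableSet_Icc]
    filter_upwards [ae_hasDerivAt_primitive hq, ae_unitVolume_mem_Ioo, hae] with x hx hx01 hxd
    have hn : Icc (0 : ℝ) 1 ∈ 𝓝 x := Icc_mem_nhds hx01.1 hx01.2
    have hx' := Ioo_subset_Icc_self hx01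
    refine ((hxd.1.sub (hx.mul ((hdy x hx').hasDerivAt hn))).sub
      ((hV x hx').hasDerivAt hn)).congr_deriv ?_
    linarith [hxd.2]
  rw [uIcc_of_le (zero_le_one' ℝ)] at hC
  refine ⟨fun x => dy x - primitive q x * y x, fun x hx => ⟨?_, ?_⟩⟩
  · exact (hdy x hx).congr_deriv (by ring)
  · have hE : ∀ x ∈ Icc (0 : ℝ) 1, dy x - primitive q x * y x = V x + C := fun x hx => by
      linarith [hC x hx]
    exact (((hV x hx).add_const C).congr hE (hE x hx)).congr_deriv (by ring)

theorem IsDirichletEigenfunction.eq_zero_iff {q : ℝ → ℝ} {μ : ℝ} {y θ : ℝ → ℝ}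
    (hq : Integrable q unitVolume) (h : IsDirichletEigenfunction q μ y)
    (hθ : IsPruferAngle (primitive q) μ θ) {x : ℝ} (hx : x ∈ Icc (0 : ℝ) 1) :
    y x = 0 ↔ sin (θ x) = 0 := by
  have hF := (continuous_primitive hq).continuousOn (s := Icc (0 : ℝ) 1)
  obtain ⟨v, hv⟩ := h.exists_isSystemSolution hq
  obtain ⟨r, hr0, hr, hrs⟩ := hθ.exists_solution hF
  have hd : IsSystemSolution (primitive q) μ (fun x => y x - v 0 * (r x * sin (θ x)))
      (fun x => v x - v 0 * (r x * cos (θ x))) := fun x hx =>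
    ⟨((hv x hx).1.sub ((hrs x hx).1.const_mul (v 0))).congr_deriv (by ring),
      ((hv x hx).2.sub ((hrs x hx).2.const_mul (v 0))).congr_deriv (by ring)⟩
  -- Both sides solve the same linear system with the same data at 0.
  have hE : ∀ x ∈ Icc (0 : ℝ) 1, y x = v 0 * (r x * sin (θ x)) := fun x hx =>
    sub_eq_zero.1 (hd.eq_zero hF (by simp [h.left_zero, hθ.1]) (by simp [hr0, hθ.1]) x hx)
  have hv0 : v 0 ≠ 0 := by
    intro h0
    obtain ⟨z, hz, hne⟩ := h.nontrivial
    exact hne (by rw [hE z hz, h0, zero_mul])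
  rw [hE x hx]
  simp [hv0, (hr x).ne']

/-! ### Eigenvalues and nodes read off from the angle. -/

theorem IsPruferAngle.mem_dirichletEigenvalues_iff {q : ℝ → ℝ} {μ : ℝ} {θ : ℝ → ℝ}
    (hq : Integrable q unitVolume) (hθ : IsPruferAngle (primitive q) μ θ) :
    μ ∈ dirichletEigenvalues q ↔ sin (θ 1) = 0 := by
  have hF := (continuous_primitive hq).continuousOn (s := Icc (0 : ℝ) 1)
  constructor
  · rintro ⟨y, hy⟩
    exact (hy.eq_zero_iff hq hθ (right_mem_Icc.2 zero_le_one)).1 hy.right_zero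
  · intro hs
    obtain ⟨r, hr0, hr, hrs⟩ := hθ.exists_solution hF
    refine ⟨_, hrs.isDirichletEigenfunction hq (by simp [hθ.1]) (by simp [hs]) ?_⟩
    by_contra! hz
    have h0 : (0 : ℝ) ∈ Icc (0 : ℝ) 1 := by simp
    have h4 := (uniqueDiffOn_Icc zero_lt_one 0 h0).eq_deriv _
      ((hasDerivWithinAt_const (0 : ℝ) (Icc (0 : ℝ) 1) (0 : ℝ)).congr hz (hz 0 h0)) (hrs 0 h0).1
    simp [hθ.1, hr0] at h4

/-- The terminal angle is continuous and strictly increasing in `μ`, and eigenvalues are its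
crossings of multiples of `π`. -/
theorem isNthEigenvalue_iff {q : ℝ → ℝ} {μ : ℝ} {θ : ℝ → ℝ} {m : ℕ}
    (hq : Integrable q unitVolume) (hθ : IsPruferAngle (primitive q) μ θ) :
    IsNthEigenvalue q m μ ↔ θ 1 = m * π := by
  have hF := (continuous_primitive hq).continuousOn (s := Icc (0 : ℝ) 1)
  obtain ⟨M, hM⟩ := isCompact_Icc.exists_bound_of_continuousOn hF
  choose Θ hΘ using fun μ => exists_isPruferAngle hF μ
  have h1m : (1 : ℝ) ∈ Ioc (0 : ℝ) 1 := by simp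
  have hmono : StrictMono fun μ => Θ μ 1 := fun a b hab => (hΘ a).strictMono hF hab (hΘ b)
  have hcont : Continuous fun μ => Θ μ 1 := by
    rw [continuous_iff_seqContinuous]
    intro μn μ hμ
    exact tendsto_isPruferAngle hF
      (tendstoUniformlyOn_iff_tendstoUniformly_comp_coe.2 (by
        rw [Metric.tendstoUniformly_iff]; exact fun ε hε => by simp [hε]))
      hμ (fun n => hΘ (μn n)) (hΘ μ) (by simp)
  have hpos : ∀ μ, 0 < Θ μ 1 := fun μ => by
    simpa using (hΘ μ).lt_of_le hF 0 le_rfl one_pos le_rfl (by simp [(hΘ μ).1])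
  have hcount : ∀ {n : ℕ}, 0 < n → Θ μ 1 = n * π →
      (dirichletEigenvalues q ∩ Iio μ).encard + 1 = (n : ℕ∞) := by
    intro n hn0 hn
    -- At or below `a` the terminal angle lies in `(0, π)`, so no eigenvalue escapes the count on
    -- `(a, μ)`.
    set a := -(2 * M ^ 2 + 3) with ha
    have haπ : ∀ b ≤ a, Θ b 1 < π := fun b hb => (hΘ b).lt_pi hM hb
    have hab : a < μ := by
      by_contra! hle
      have h1 := haπ μ hle
      have : (1 : ℝ) ≤ n := by exact_mod_cast hn0
      rw [hn] at h1
      nlinarith [pi_pos]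
    rw [← encard_crossings hab hcont.continuousOn
      (fun k s _ t _ hst hk => hk.trans_lt (hmono hst)) (hpos a).le (haπ a le_rfl) hn]
    congr 2
    ext b
    simp only [mem_inter_iff, (hΘ b).mem_dirichletEigenvalues_iff hq, mem_Iio, mem_Ioo,
      mem_ofPred_eq]
    constructor
    · rintro ⟨hs, hb⟩
      refine ⟨⟨?_, hb⟩, hs⟩
      by_contra! hle
      exact (sin_pos_of_pos_of_lt_pi (hpos b) (haπ b hle)).ne' hs
    · rintro ⟨⟨-, hb⟩, hs⟩
      exact ⟨hs, hb⟩
  have hΘθ : Θ μ 1 = θ 1 :=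
    tendsto_nhds_unique tendsto_const_nhds (tendsto_isPruferAngle (Fn := fun _ => primitive q)
      (μn := fun _ => μ) (θn := fun _ => Θ μ) hF
      (tendstoUniformlyOn_iff_tendstoUniformly_comp_coe.2 (by
        rw [Metric.tendstoUniformly_iff]; exact fun ε hε => by simp [hε]))
      tendsto_const_nhds (fun _ => hΘ μ) hθ (by simp))
  have hn0 : ∀ {n : ℕ}, Θ μ 1 = n * π → 0 < n := fun {n} hn => by
    rcases Nat.eq_zero_or_pos n with rfl | h
    · have := hpos μ
      rw [hn] at this
      simp at this
    · exact h
  rw [IsNthEigenvalue, (hΘ μ).mem_dirichletEigenvalues_iff hq, ← hΘθ]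
  constructor
  · rintro ⟨hs, hm⟩
    obtain ⟨n, hn⟩ := (hΘ μ).exists_nat hF h1m hs
    rw [hcount (hn0 hn) hn] at hm
    rw [hn, Nat.cast_inj.1 hm]
  · intro hm
    exact ⟨by rw [hm, sin_nat_mul_pi], hcount (hn0 hm) hm⟩

theorem isNode_iff {q : ℝ → ℝ} {i m : ℕ} {T : ℝ} (hq : Integrable q unitVolume)
    (hT : T ∈ Ioo (0 : ℝ) 1) :
    IsNode q i m T ↔
      ∃ μ θ, IsPruferAngle (primitive q) μ θ ∧ θ 1 = m * π ∧ θ T = i * π := by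
  have hF := (continuous_primitive hq).continuousOn (s := Icc (0 : ℝ) 1)
  have hset : ∀ {μ y θ}, IsDirichletEigenfunction q μ y → IsPruferAngle (primitive q) μ θ →
      {x ∈ Ioo (0 : ℝ) T | y x = 0} = {x ∈ Ioo 0 T | sin (θ x) = 0} := fun hy hθ => by
    ext x
    simp only [mem_ofPred_eq, and_congr_right_iff]
    exact fun hx => hy.eq_zero_iff hq hθ ⟨hx.1.le, hx.2.le.trans hT.2.le⟩
  constructor
  · rintro ⟨μ, y, hm, hy, -, hyT, hc⟩
    obtain ⟨θ, hθ⟩ := exists_isPruferAngle hF μ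
    refine ⟨μ, θ, hθ, (isNthEigenvalue_iff hq hθ).1 hm, ?_⟩
    obtain ⟨n, hn⟩ := hθ.exists_nat hF ⟨hT.1, hT.2.le⟩
      ((hy.eq_zero_iff hq hθ (Ioo_subset_Icc_self hT)).1 hyT)
    rw [hset hy hθ, hθ.encard_zeros hF ⟨hT.1, hT.2.le⟩ hn] at hc
    rw [hn, Nat.cast_inj.1 hc]
  · rintro ⟨μ, θ, hθ, h1, hi⟩
    have hm := (isNthEigenvalue_iff hq hθ).2 h1
    obtain ⟨y, hy⟩ := hm.1
    refine ⟨μ, y, hm, hy, hT, ?_, ?_⟩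
    · rw [hy.eq_zero_iff hq hθ (Ioo_subset_Icc_self hT), hi, sin_nat_mul_pi]
    · rw [hset hy hθ, hθ.encard_zeros hF ⟨hT.1, hT.2.le⟩ hi]

/-! ### Lower semicontinuity of the norm, through primitives. -/

/-- Jensen's inequality for `ν`, then Tonelli and translation invariance. -/
theorem eLpNorm_integral_translate_le {f : ℝ → ℝ} (hf : StronglyMeasurable f) (ν : Measure ℝ)
    [IsProbabilityMeasure ν] {p : ℝ≥0∞} (hp_one : 1 ≤ p) (hp_top : p < ∞) :
    eLpNorm (fun x => ∫ s, f (x + s) ∂ν) p volume ≤ eLpNorm f p volume := by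
  have hp0 : p ≠ 0 := (zero_lt_one.trans_le hp_one).ne'
  have hpr : 0 < p.toReal := ENNReal.toReal_pos hp0 hp_top.ne
  have hpt : ∀ x, ‖∫ s, f (x + s) ∂ν‖ₑ ^ p.toReal ≤ ∫⁻ s, ‖f (x + s)‖ₑ ^ p.toReal ∂ν := by
    intro x
    have hm : AEStronglyMeasurable (fun s => f (x + s)) ν :=
      (hf.comp_measurable (measurable_const_add x)).aestronglyMeasurable
    have h1 := eLpNorm_le_eLpNorm_of_exponent_le hp_one hm
    rw [eLpNorm_one_eq_lintegral_enorm, eLpNorm_eq_lintegral_rpow_enorm_toReal hp0 hp_top.ne,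
      one_div, ENNReal.le_rpow_inv_iff hpr] at h1
    exact (ENNReal.rpow_le_rpow (enorm_integral_le_lintegral_enorm _) hpr.le).trans h1
  rw [eLpNorm_eq_lintegral_rpow_enorm_toReal hp0 hp_top.ne,
    eLpNorm_eq_lintegral_rpow_enorm_toReal hp0 hp_top.ne]
  refine ENNReal.rpow_le_rpow ?_ (by positivity)
  calc ∫⁻ x, ‖∫ s, f (x + s) ∂ν‖ₑ ^ p.toReal
      ≤ ∫⁻ x, ∫⁻ s, ‖f (x + s)‖ₑ ^ p.toReal ∂ν := lintegral_mono hpt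
    _ = ∫⁻ s, (∫⁻ x, ‖f (x + s)‖ₑ ^ p.toReal) ∂ν := by
        refine lintegral_lintegral_swap (μ := volume) (ν := ν)
          (f := fun x s => ‖f (x + s)‖ₑ ^ p.toReal) ?_
        exact ((hf.measurable.comp (measurable_fst.add measurable_snd)).enorm.pow_const
          p.toReal).aemeasurable
    _ = ∫⁻ _, (∫⁻ x, ‖f x‖ₑ ^ p.toReal) ∂ν := by
        refine lintegral_congr fun s => ?_
        exact lintegral_add_right_eq_self (fun x => ‖f x‖ₑ ^ p.toReal) s
    _ = _ := by simp

theorem eLpNorm_slope_integral_le {f : ℝ → ℝ} (hf : StronglyMeasurable f) {h : ℝ} (hh : 0 < h)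
    {p : ℝ≥0∞} (hp_one : 1 ≤ p) (hp_top : p < ∞) :
    eLpNorm (fun x => h⁻¹ * ∫ t in x..x + h, f t) p volume ≤ eLpNorm f p volume := by
  have hne : ENNReal.ofReal h ≠ 0 := by simpa using hh
  set ν : Measure ℝ := (ENNReal.ofReal h)⁻¹ • volume.restrict (Ioc 0 h) with hν
  have : IsProbabilityMeasure ν := ⟨by
    rw [hν, Measure.smul_apply, Measure.restrict_apply_univ, Real.volume_Ioc, sub_zero, smul_eq_mul,
      ENNReal.inv_mul_cancel hne ENNReal.ofReal_ne_top]⟩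
  convert! eLpNorm_integral_translate_le hf ν hp_one hp_top using 2
  ext x
  rw [hν, integral_smul_measure, ENNReal.toReal_inv, ENNReal.toReal_ofReal hh.le, smul_eq_mul,
    ← intervalIntegral.integral_of_le hh.le, intervalIntegral.integral_comp_add_left, add_zero]

theorem eLpNorm_slope_primitive_le {g : ℝ → ℝ} (hg : StronglyMeasurable g)
    (hgi : Integrable g unitVolume) {h : ℝ} (hh : 0 < h)
    {p : ℝ≥0∞} (hp_one : 1 ≤ p) (hp_top : p < ∞) :
    eLpNorm (fun x => h⁻¹ * (primitive g (x + h) - primitive g x)) p unitVolume ≤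
      eLpNorm g p unitVolume := by
  rw [← eLpNorm_indicator_eq_eLpNorm_restrict (f := g) measurableSet_Icc]
  refine le_trans (eLpNorm_mono_measure _ Measure.restrict_le_self) ?_
  convert! eLpNorm_slope_integral_le (hg.indicator measurableSet_Icc) hh hp_one hp_top using 3
    with x
  exact congrArg _ (intervalIntegral.integral_interval_sub_left
    (integrable_indicator_Icc hgi).intervalIntegrable
    (integrable_indicator_Icc hgi).intervalIntegrable)

theorem primitive_of_one_le {g : ℝ → ℝ} (hg : Integrable g unitVolume) {x : ℝ} (hx : 1 ≤ x) :
    primitive g x = primitive g 1 := by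
  have hi := integrable_indicator_Icc hg
  rw [← sub_eq_zero, primitive, primitive,
    intervalIntegral.integral_interval_sub_left hi.intervalIntegrable hi.intervalIntegrable,
    intervalIntegral.integral_of_le hx]
  refine setIntegral_eq_zero_of_forall_eq_zero fun t ht => indicator_of_notMem ?_ _
  exact fun h => absurd h.2 (not_le.2 ht.1)

theorem primitive_congr_ae {f g : ℝ → ℝ} (h : f =ᵐ[unitVolume] g) : primitive f = primitive g := by
  have h' : (Icc (0 : ℝ) 1).indicator f =ᵐ[volume] (Icc (0 : ℝ) 1).indicator g := by
    rw [EventuallyEq, ae_restrict_iff' measurableSet_Icc] at h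
    filter_upwards [h] with x hx
    by_cases hx' : x ∈ Icc (0 : ℝ) 1
    · rw [indicator_of_mem hx', indicator_of_mem hx', hx hx']
    · rw [indicator_of_notMem hx', indicator_of_notMem hx']
  ext x
  exact intervalIntegral.integral_congr_ae (h'.mono fun t ht _ => ht)

theorem primitive_add {f g : ℝ → ℝ} (hf : Integrable f unitVolume) (hg : Integrable g unitVolume) :
    primitive (f + g) = primitive f + primitive g := by
  ext x
  simp only [primitive, Pi.add_apply, indicator_add']
  exact intervalIntegral.integral_add (integrable_indicator_Icc hf).intervalIntegrable
    (integrable_indicator_Icc hg).intervalIntegrable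

/-- Difference quotients of the primitives of `gn` are averages of `gn`, hence eventually bounded by
`D`. Fatou's lemma carries the bound to the quotients of `primitive g`, and again, with Lebesgue
differentiation, to `g`. -/
theorem eLpNorm_le_of_tendsto_primitive {p : ℝ≥0∞} (hp_one : 1 ≤ p) (hp_top : p < ∞)
    {gn : ℕ → ℝ → ℝ} {g : ℝ → ℝ} {D : ℝ≥0∞} (hm : ∀ n, StronglyMeasurable (gn n))
    (hn : ∀ n, Integrable (gn n) unitVolume) (hg : Integrable g unitVolume)
    (hlim : ∀ x ∈ Icc (0 : ℝ) 1, Tendsto (fun n => primitive (gn n) x) atTop (𝓝 (primitive g x)))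
    (hD : ∀ᶠ n in atTop, eLpNorm (gn n) p unitVolume ≤ D) : eLpNorm g p unitVolume ≤ D := by
  have hlim' : ∀ x, 0 ≤ x → Tendsto (fun n => primitive (gn n) x) atTop (𝓝 (primitive g x)) := by
    intro x hx
    rcases le_total x 1 with h1 | h1
    · exact hlim x ⟨hx, h1⟩
    · simpa only [primitive_of_one_le (hn _) h1, primitive_of_one_le hg h1] using hlim 1 (by simp)
  have hslope : ∀ h : ℝ, 0 < h →
      eLpNorm (fun x => h⁻¹ * (primitive g (x + h) - primitive g x)) p unitVolume ≤ D := by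
    intro h hh
    refine Lp.eLpNorm_le_of_ae_tendsto (u := atTop)
      (f := fun n x => h⁻¹ * (primitive (gn n) (x + h) - primitive (gn n) x)) ?_ ?_ ?_
    · filter_upwards [hD] with n hnD
      exact (eLpNorm_slope_primitive_le (hm n) (hn n) hh hp_one hp_top).trans hnD
    · intro n
      have := continuous_primitive (hn n)
      exact (by fun_prop : Continuous _).aestronglyMeasurable
    · filter_upwards [ae_restrict_mem measurableSet_Icc] with x hx
      exact ((hlim' (x + h) (by linarith [hx.1])).sub (hlim x hx)).const_mul _
  have hu : Tendsto (fun n : ℕ => 1 / ((n : ℝ) + 1)) atTop (𝓝[≠] 0) :=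
    tendsto_nhdsWithin_iff.2 ⟨tendsto_one_div_add_atTop_nhds_zero_nat,
      Eventually.of_forall fun n => by
        have : (0 : ℝ) < 1 / ((n : ℝ) + 1) := by positivity
        exact this.ne'⟩
  refine Lp.eLpNorm_le_of_ae_tendsto (u := atTop)
    (f := fun (n : ℕ) x => (1 / ((n : ℝ) + 1))⁻¹ *
      (primitive g (x + 1 / ((n : ℝ) + 1)) - primitive g x))
    (Eventually.of_forall fun n => hslope _ (by positivity)) ?_ ?_
  · intro n
    have := continuous_primitive hg
    exact (by fun_prop : Continuous _).aestronglyMeasurable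
  · filter_upwards [ae_hasDerivAt_primitive hg] with x hx
    exact hx.tendsto_slope_zero.comp hu

/-! ### Compactness of bounded sets of potentials. -/

/-- Hölder's inequality on a disjoint union of intervals. One interval gives the modulus of
continuity for Arzelà–Ascoli, finitely many give absolute continuity of the limit. -/
theorem sum_edist_primitive_le {p C : ℝ≥0∞} (hp_one : 1 ≤ p) {g : ℝ → ℝ}
    (hg : MemLp g p unitVolume) (hC : eLpNorm g p unitVolume ≤ C)
    {E : ℕ × (ℕ → ℝ × ℝ)} (hE : E ∈ AbsolutelyContinuousOnInterval.disjWithin 0 1) :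
    ∑ i ∈ Finset.range E.1, edist (primitive g (E.2 i).1) (primitive g (E.2 i).2) ≤
      C * (∑ i ∈ Finset.range E.1, edist (E.2 i).1 (E.2 i).2) ^ (1 - 1 / p.toReal) := by
  have hgi : Integrable g unitVolume := hg.integrable hp_one
  have hi := integrable_indicator_Icc hgi
  -- For `p = ∞` the convention `p.toReal = 0` yields the correct exponent 1.
  set γ := 1 - 1 / p.toReal with hγ
  have hγ0 : 0 ≤ γ := by
    rcases eq_or_ne p ∞ with rfl | hp
    · simp [hγ]
    · have : 1 ≤ p.toReal := by
        rw [← ENNReal.toReal_one]; exact ENNReal.toReal_mono hp hp_one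
      rw [hγ, sub_nonneg]
      exact div_le_one_of_le₀ this (by linarith)
  set S := ⋃ i ∈ Finset.range E.1, uIoc (E.2 i).1 (E.2 i).2 with hS
  have h1 : ∀ a b : ℝ, edist (primitive g a) (primitive g b) ≤
      ∫⁻ t in uIoc a b, ‖(Icc (0 : ℝ) 1).indicator g t‖ₑ := by
    intro a b
    rw [edist_comm, edist_eq_enorm_sub, primitive, primitive,
      intervalIntegral.integral_interval_sub_left hi.intervalIntegrable hi.intervalIntegrable,
      ← enorm_norm, intervalIntegral.norm_intervalIntegral_eq, enorm_norm]
    exact enorm_integral_le_lintegral_enorm _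
  calc ∑ i ∈ Finset.range E.1, edist (primitive g (E.2 i).1) (primitive g (E.2 i).2)
      ≤ ∑ i ∈ Finset.range E.1, ∫⁻ t in uIoc (E.2 i).1 (E.2 i).2,
          ‖(Icc (0 : ℝ) 1).indicator g t‖ₑ := Finset.sum_le_sum fun i _ => h1 _ _
    _ = ∫⁻ t in S, ‖(Icc (0 : ℝ) 1).indicator g t‖ₑ :=
        (lintegral_biUnion_finset hE.2 (fun i _ => measurableSet_uIoc) _).symm
    _ = eLpNorm ((Icc (0 : ℝ) 1).indicator g) 1 (volume.restrict S) :=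
        eLpNorm_one_eq_lintegral_enorm.symm
    _ ≤ eLpNorm ((Icc (0 : ℝ) 1).indicator g) p (volume.restrict S) *
          (volume.restrict S) univ ^ (1 / (1 : ℝ≥0∞).toReal - 1 / p.toReal) :=
        eLpNorm_le_eLpNorm_mul_rpow_measure_univ hp_one hi.aestronglyMeasurable.restrict
    _ ≤ C * (∑ i ∈ Finset.range E.1, edist (E.2 i).1 (E.2 i).2) ^ γ := by
        rw [ENNReal.toReal_one, div_one, Measure.restrict_apply_univ]
        refine mul_le_mul' ((eLpNorm_mono_measure _ Measure.restrict_le_self).trans ?_)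
          (ENNReal.rpow_le_rpow ((measure_biUnion_finset_le _ _).trans ?_) hγ0)
        · rwa [eLpNorm_indicator_eq_eLpNorm_restrict measurableSet_Icc]
        · refine Finset.sum_le_sum fun i _ => ?_
          rw [uIoc, Real.volume_Ioc, edist_dist, Real.dist_eq, max_sub_min_eq_abs']

theorem edist_primitive_le {p C : ℝ≥0∞} (hp_one : 1 ≤ p) {g : ℝ → ℝ}
    (hg : MemLp g p unitVolume) (hC : eLpNorm g p unitVolume ≤ C) {a b : ℝ}
    (ha : a ∈ Icc (0 : ℝ) 1) (hb : b ∈ Icc (0 : ℝ) 1) :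
    edist (primitive g a) (primitive g b) ≤ C * edist a b ^ (1 - 1 / p.toReal) := by
  have := sum_edist_primitive_le hp_one hg hC (E := (1, fun _ => (a, b)))
    ⟨fun i _ => by simpa [uIcc_of_le (zero_le_one' ℝ)] using ⟨ha, hb⟩, by simp⟩
  simpa using this

theorem norm_primitive_le {p C : ℝ≥0∞} (hp_one : 1 ≤ p) {g : ℝ → ℝ}
    (hg : MemLp g p unitVolume) (hC : C ≠ ∞) (hgC : eLpNorm g p unitVolume ≤ C) {x : ℝ}
    (hx : x ∈ Icc (0 : ℝ) 1) : ‖primitive g x‖ ≤ C.toReal := by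
  have h := edist_primitive_le hp_one hg hgC hx (left_mem_Icc.2 zero_le_one)
  have h0 : primitive g 0 = 0 := by simp [primitive]
  have hle : edist x 0 ≤ 1 := by
    rw [edist_dist, ENNReal.ofReal_le_one, Real.dist_eq, sub_zero, abs_of_nonneg hx.1]
    exact hx.2
  have hγ0 : 0 ≤ 1 - 1 / p.toReal := by
    rcases eq_or_ne p ∞ with rfl | hp
    · simp
    · have : 1 ≤ p.toReal := by
        rw [← ENNReal.toReal_one]; exact ENNReal.toReal_mono hp hp_one
      rw [sub_nonneg]
      exact div_le_one_of_le₀ this (by linarith)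
  rw [h0] at h
  rw [← dist_zero_right, dist_edist]
  refine ENNReal.toReal_mono hC (h.trans ?_)
  calc _ ≤ C * 1 := by gcongr; exact ENNReal.rpow_le_one hle hγ0
    _ = C := mul_one C

theorem tendsto_const_mul_ofReal_rpow {C : ℝ≥0∞} (hC : C ≠ ∞) {γ : ℝ} (hγ : 0 < γ) :
    Tendsto (fun t : ℝ => C * ENNReal.ofReal t ^ γ) (𝓝 0) (𝓝 0) := by
  have h1 : Tendsto (fun t : ℝ => ENNReal.ofReal t ^ γ) (𝓝 0) (𝓝 0) := by
    have : Continuous fun t : ℝ => ENNReal.ofReal t ^ γ :=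
      ENNReal.continuous_rpow_const.comp ENNReal.continuous_ofReal
    simpa [hγ] using this.tendsto 0
  simpa using ENNReal.Tendsto.const_mul h1 (Or.inr hC)

/-- Weak sequential compactness of balls of `L^p`, in terms of primitives. -/
theorem exists_tendstoUniformlyOn_primitive {p : ℝ≥0∞} (hp_one : 1 < p) (hp_top : p < ∞)
    {gn : ℕ → ℝ → ℝ} {C : ℝ≥0∞} (hC : C ≠ ∞) (hm : ∀ n, StronglyMeasurable (gn n))
    (hgn : ∀ n, eLpNorm (gn n) p unitVolume ≤ C) :
    ∃ (g : ℝ → ℝ) (φ : ℕ → ℕ), StrictMono φ ∧ MemLp g p unitVolume ∧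
      TendstoUniformlyOn (fun n => primitive (gn (φ n))) (primitive g) atTop (Icc 0 1) ∧
      ∀ D, (∀ᶠ n in atTop, eLpNorm (gn n) p unitVolume ≤ D) → eLpNorm g p unitVolume ≤ D := by
  have hmem : ∀ n, MemLp (gn n) p unitVolume := fun n =>
    ⟨(hm n).aestronglyMeasurable, (hgn n).trans_lt hC.lt_top⟩
  have hint : ∀ n, Integrable (gn n) unitVolume := fun n => (hmem n).integrable hp_one.le
  set γ := 1 - 1 / p.toReal with hγ
  have hγ0 : 0 < γ := by
    have : 1 < p.toReal := by
      rw [← ENNReal.toReal_one]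
      exact (ENNReal.toReal_lt_toReal ENNReal.one_ne_top hp_top.ne).2 hp_one
    rw [hγ, sub_pos]
    exact (div_lt_one (by linarith)).2 this
  set b : ℝ → ℝ := fun t => (C * ENNReal.ofReal t ^ γ).toReal with hb
  have hb0 : Tendsto b (𝓝 0) (𝓝 0) := by
    simpa using! (ENNReal.tendsto_toReal ENNReal.zero_ne_top).comp
      (tendsto_const_mul_ofReal_rpow hC hγ0)
  have hfin : ∀ t : ℝ, C * ENNReal.ofReal t ^ γ ≠ ∞ := fun t =>
    ENNReal.mul_ne_top hC (ENNReal.rpow_ne_top_of_nonneg hγ0.le ENNReal.ofReal_ne_top)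
  have hmod : ∀ n, ∀ x ∈ Icc (0 : ℝ) 1, ∀ y ∈ Icc (0 : ℝ) 1,
      dist (primitive (gn n) x) (primitive (gn n) y) ≤ b (dist x y) := by
    intro n x hx y hy
    have h := edist_primitive_le hp_one.le (hmem n) (hgn n) hx hy
    rw [edist_dist x y] at h
    rw [dist_edist]
    exact ENNReal.toReal_mono (hfin _) h
  set fn : ℕ → BoundedContinuousFunction (Icc (0 : ℝ) 1) ℝ := fun n =>
    BoundedContinuousFunction.mkOfCompact
      ⟨fun x => primitive (gn n) x, (continuous_primitive (hint n)).comp continuous_subtype_val⟩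
    with hfn
  have hcomp : IsCompact (closure (range fn)) := by
    refine BoundedContinuousFunction.arzela_ascoli (Metric.closedBall (0 : ℝ) C.toReal)
      (isCompact_closedBall _ _) _ ?_ ?_
    · rintro _ x ⟨n, rfl⟩
      rw [mem_closedBall_zero_iff]
      exact norm_primitive_le hp_one.le (hmem n) hC (hgn n) x.2
    · refine Metric.equicontinuous_of_continuity_modulus b hb0 _ ?_
      rintro x y ⟨_, n, rfl⟩
      exact hmod n x x.2 y y.2
  obtain ⟨f, -, φ, hφ, hf⟩ := hcomp.tendsto_subseq fun n => subset_closure (mem_range_self n)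
  set F : ℝ → ℝ := fun x => f (projIcc 0 1 zero_le_one x) with hF
  have hFu : TendstoUniformlyOn (fun n => primitive (gn (φ n))) F atTop (Icc 0 1) := by
    have h := BoundedContinuousFunction.tendsto_iff_tendstoUniformly.1 hf
    rw [Metric.tendstoUniformly_iff] at h
    rw [Metric.tendstoUniformlyOn_iff]
    intro ε hε
    filter_upwards [h ε hε] with n hn x hx
    simpa [hF, projIcc_of_mem _ hx] using! hn ⟨x, hx⟩
  have hpt : ∀ x ∈ Icc (0 : ℝ) 1, Tendsto (fun n => primitive (gn (φ n)) x) atTop (𝓝 (F x)) :=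
    fun x hx => hFu.tendsto_at hx
  -- The Hölder estimate is uniform in `n` and survives pointwise limits; `γ > 0`, that is `p > 1`,
  -- makes it small. Hence the limit is the primitive of its derivative.
  have hac : AbsolutelyContinuousOnInterval F 0 1 := by
    rw [absolutelyContinuousOnInterval_iff]
    intro ε hε
    obtain ⟨δ, hδ, hδε⟩ := ((((tendsto_const_mul_ofReal_rpow hC hγ0).mono_left
      nhdsWithin_le_nhds).eventually (gt_mem_nhds (ENNReal.ofReal_pos.2 hε))).and
      (self_mem_nhdsWithin (s := Ioi 0))).exists.imp fun δ h => And.symm h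
    refine ⟨δ, hδ, fun E hE hlt => ?_⟩
    have hofReal : ∀ G : ℝ → ℝ, ENNReal.ofReal (∑ i ∈ Finset.range E.1,
        dist (G (E.2 i).1) (G (E.2 i).2)) =
        ∑ i ∈ Finset.range E.1, edist (G (E.2 i).1) (G (E.2 i).2) := fun G => by
      simp_rw [edist_dist]
      exact ENNReal.ofReal_sum_of_nonneg fun _ _ => dist_nonneg
    rw [← ENNReal.ofReal_lt_ofReal_iff hε, hofReal]
    refine lt_of_le_of_lt ?_ hδε
    refine le_of_tendsto' (x := atTop) (f := fun n => ∑ i ∈ Finset.range E.1,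
      edist (primitive (gn (φ n)) (E.2 i).1) (primitive (gn (φ n)) (E.2 i).2)) ?_ fun n => ?_
    · refine tendsto_finsetSum _ fun i hi => ?_
      have := hE.1 i hi
      rw [uIcc_of_le (zero_le_one' ℝ)] at this
      exact (hpt _ this.1).edist (hpt _ this.2)
    · refine (sum_edist_primitive_le hp_one.le (hmem _) (hgn _) hE).trans ?_
      have h3 := (hofReal id).symm
      simp only [id] at h3
      rw [h3]
      gcongr
  have hgi : Integrable (deriv F) unitVolume := by
    have := hac.intervalIntegrable_deriv
    rwa [intervalIntegrable_iff_integrableOn_Icc_of_le zero_le_one] at this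
  have hF0 : F 0 = 0 :=
    tendsto_nhds_unique (hpt 0 (by simp)) (by simp [primitive])
  have hprim : ∀ x ∈ Icc (0 : ℝ) 1, primitive (deriv F) x = F x := by
    intro x hx
    have h := (hac.mono (c := 0) (d := x) (by
      rw [uIcc_of_le hx.1, uIcc_of_le (zero_le_one' ℝ)]
      exact Icc_subset_Icc_right hx.2)).integral_deriv_eq_sub
    rw [hF0, sub_zero] at h
    rw [← h, primitive]
    refine intervalIntegral.integral_congr fun t ht => ?_
    rw [uIcc_of_le hx.1] at ht
    have ht' : t ∈ Icc (0 : ℝ) 1 := ⟨ht.1, ht.2.trans hx.2⟩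
    exact indicator_of_mem ht' (deriv F)
  have hbound : ∀ D, (∀ᶠ n in atTop, eLpNorm (gn n) p unitVolume ≤ D) →
      eLpNorm (deriv F) p unitVolume ≤ D := fun D hD =>
    eLpNorm_le_of_tendsto_primitive hp_one.le hp_top (fun n => hm (φ n)) (fun n => hint (φ n)) hgi
      (fun x hx => by rw [hprim x hx]; exact hpt x hx) (hφ.tendsto_atTop.eventually hD)
  exact ⟨deriv F, φ, hφ, ⟨hgi.aestronglyMeasurable,
    (hbound C (Eventually.of_forall hgn)).trans_lt hC.lt_top⟩,
    hFu.congr_right fun x hx => (hprim x hx).symm, hbound⟩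

/-! ### An explicit admissible potential. -/

theorem hasDerivAt_ite_le {f g d : ℝ → ℝ} {c : ℝ} (hf : ∀ x ≤ c, HasDerivAt f (d x) x)
    (hg : ∀ x, c ≤ x → HasDerivAt g (d x) x) (hc : f c = g c) (x : ℝ) :
    HasDerivAt (fun x => if x ≤ c then f x else g x) (d x) x := by
  rcases lt_trichotomy x c with h | rfl | h
  · refine (hf x h.le).congr_of_eventuallyEq ?_
    filter_upwards [Iio_mem_nhds h] with t ht
    exact if_pos (le_of_lt ht)
  · rw [← hasDerivWithinAt_univ, ← Iic_union_Ici (a := x)]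
    have h1 : ∀ t ∈ Iic x, (if t ≤ x then f t else g t) = f t := fun t ht => if_pos ht
    refine ((hf x le_rfl).hasDerivWithinAt.congr h1 (if_pos le_rfl)).union
      ((hg x le_rfl).hasDerivWithinAt.congr (fun t ht => ?_) ((if_pos le_rfl).trans hc))
    rcases (mem_Ici.1 ht).eq_or_lt with rfl | h
    · exact (if_pos le_rfl).trans hc
    · exact if_neg (not_le.2 h)
  · refine (hg x h.le).congr_of_eventuallyEq ?_
    filter_upwards [Ioi_mem_nhds h] with t ht
    exact if_neg (not_le.2 ht)

/-- At a zero of `y` the angle is determined by the number of earlier zeros, so any increasing phase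
`g` with the same zeros gives its value there. -/
theorem IsDirichletEigenfunction.isPruferAngle_eq {q : ℝ → ℝ} {μ : ℝ} {y θ g : ℝ → ℝ}
    (hq : Integrable q unitVolume) (h : IsDirichletEigenfunction q μ y)
    (hθ : IsPruferAngle (primitive q) μ θ) (hgc : ContinuousOn g (Icc 0 1))
    (hg : StrictMonoOn g (Icc 0 1)) (hg0 : g 0 = 0)
    (hgy : ∀ x ∈ Icc (0 : ℝ) 1, y x = 0 ↔ sin (g x) = 0) {x : ℝ} (hx : x ∈ Ioc (0 : ℝ) 1) {n : ℕ}
    (hn : g x = n * π) : θ x = n * π := by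
  have hF := (continuous_primitive hq).continuousOn (s := Icc (0 : ℝ) 1)
  have hs : ∀ t ∈ Icc (0 : ℝ) 1, sin (θ t) = 0 ↔ sin (g t) = 0 := fun t ht => by
    rw [← h.eq_zero_iff hq hθ ht, hgy t ht]
  have hsub : Icc 0 x ⊆ Icc 0 1 := Icc_subset_Icc_right hx.2
  obtain ⟨k, hk⟩ := hθ.exists_nat hF hx
    ((hs x (Ioc_subset_Icc_self hx)).2 (by rw [hn, sin_nat_mul_pi]))
  have h1 := hθ.encard_zeros hF hx hk
  have h2 := encard_crossings hx.1 (hgc.mono hsub)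
    (fun k s hs t ht hst hk => hk.trans_lt (hg (hsub hs) (hsub ht) hst)) hg0.ge
    (hg0.trans_lt pi_pos) hn
  have h3 : {t ∈ Ioo 0 x | sin (θ t) = 0} = {t ∈ Ioo 0 x | sin (g t) = 0} := by
    ext t
    simp only [mem_ofPred_eq, and_congr_right_iff]
    exact fun ht => hs t (hsub (Ioo_subset_Icc_self ht))
  rw [h3, h2] at h1
  rw [hk, Nat.cast_inj.1 h1]

theorem admissiblePotentials_nonempty (p : ℝ≥0∞) (hp_one : 1 ≤ p) {i m : ℕ} (hi : 1 ≤ i)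
    (him : i < m) {T : ℝ} (hT : T ∈ Ioo (0 : ℝ) 1) : (admissiblePotentials p i m T).Nonempty := by
  have hi0 : (0 : ℝ) < i := by exact_mod_cast hi
  have hmi : (0 : ℝ) < m - i := sub_pos.2 (by exact_mod_cast him)
  have hT1 : 0 < 1 - T := sub_pos.2 hT.2
  -- The eigenfunction, for eigenvalue 0, has `i` half-waves on `[0, T]` and `m - i` on `[T, 1]`;
  -- `φ` counts them.
  set a : ℝ := i / T with ha
  set b : ℝ := (m - i) / (1 - T) with hb
  have ha0 : 0 < a := div_pos hi0 hT.1
  have hb0 : 0 < b := div_pos hmi hT1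
  have haT : a * T = i := div_mul_cancel₀ _ hT.1.ne'
  have hbT : b * (1 - T) = m - i := div_mul_cancel₀ _ hT1.ne'
  set φ : ℝ → ℝ := fun x => a * min x T + b * max (x - T) 0 with hφ
  have hφl : ∀ x ≤ T, φ x = a * x := fun x hx => by
    simp [hφ, min_eq_left hx, max_eq_right (sub_nonpos.2 hx)]
  have hφr : ∀ x, T ≤ x → φ x = i + b * (x - T) := fun x hx => by
    simp [hφ, min_eq_right hx, max_eq_left (sub_nonneg.2 hx), haT]
  have hφm : StrictMono φ := by
    intro x y hxy
    rcases le_total x T with h1 | h1 <;> rcases le_total y T with h2 | h2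
    · rw [hφl x h1, hφl y h2]; gcongr
    · rw [hφl x h1, hφr y h2, ← haT]
      rcases h1.eq_or_lt with rfl | h1
      · nlinarith
      · nlinarith
    · exact absurd (h2.trans h1) (not_le.2 hxy)
    · rw [hφr x h1, hφr y h2]; gcongr
  have hφc : Continuous φ := by fun_prop
  -- Dividing by the frequencies makes both slopes equal to `π cos (π φ)`, so the pieces join in a
  -- `C¹` way at `T`.
  set y₁ : ℝ → ℝ := fun x => sin (π * (a * x)) / a with hy₁
  set y₂ : ℝ → ℝ := fun x => sin (π * (i + b * (x - T))) / b with hy₂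
  set y : ℝ → ℝ := fun x => if x ≤ T then y₁ x else y₂ x with hy
  set q : ℝ → ℝ := fun x => if x ≤ T then -(π * a) ^ 2 else -(π * b) ^ 2 with hq
  set dy : ℝ → ℝ := fun x => π * cos (π * φ x) with hdy
  have hlin₁ : ∀ x, HasDerivAt (fun x => π * (a * x)) (π * a) x := fun x =>
    (((hasDerivAt_id x).const_mul a).const_mul π).congr_deriv (by ring)
  have hlin₂ : ∀ x, HasDerivAt (fun x => π * (i + b * (x - T))) (π * b) x := fun x =>
    (((((hasDerivAt_id x).sub_const T).const_mul b).const_add (i : ℝ)).const_mul π).congr_deriv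
      (by ring)
  have hyd : ∀ x, HasDerivAt y (dy x) x := by
    refine hasDerivAt_ite_le (fun x hx => ?_) (fun x hx => ?_) ?_
    · refine ((hlin₁ x).sin.div_const a).congr_deriv ?_
      rw [hdy]
      simp only [hφl x hx]
      field_simp
    · refine ((hlin₂ x).sin.div_const b).congr_deriv ?_
      rw [hdy]
      simp only [hφr x hx]
      field_simp
    · simp [hy₁, hy₂, haT, mul_comm π, sin_nat_mul_pi]
  have hy0 : ∀ x, y x = 0 ↔ sin (φ x * π) = 0 := by
    intro x
    rw [mul_comm (φ x)]
    rcases le_or_gt x T with h | h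
    · simp [hy, h, hy₁, hφl x h, ha0.ne']
    · simp [hy, not_le.2 h, hy₂, hφr x h.le, hb0.ne']
  have hφ0 : φ 0 = 0 := by rw [hφl 0 hT.1.le, mul_zero]
  have hφ1 : φ 1 = m := by rw [hφr 1 hT.2.le, hbT]; ring
  have hφT : φ T = i := by rw [hφl T le_rfl, haT]
  have hac : AbsolutelyContinuousOnInterval dy 0 1 := by
    refine LipschitzOnWith.absolutelyContinuousOnInterval
      (K := (π * (π * (a + b))).toNNReal) (LipschitzWith.lipschitzOnWith ?_)
    refine LipschitzWith.of_dist_le_mul fun s t => ?_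
    have h1 : |min s T - min t T| ≤ |s - t| := by
      simpa [Real.dist_eq] using (LipschitzWith.id.min_const T).dist_le_mul s t
    have h2 : |max (s - T) 0 - max (t - T) 0| ≤ |s - t| := by
      simpa [Real.dist_eq] using (LipschitzWith.id.max_const 0).dist_le_mul (s - T) (t - T)
    have h3 : |φ s - φ t| ≤ (a + b) * |s - t| := by
      calc _ = |a * (min s T - min t T) + b * (max (s - T) 0 - max (t - T) 0)| := by
            simp only [hφ]; ring_nf
        _ ≤ a * |min s T - min t T| + b * |max (s - T) 0 - max (t - T) 0| := by
            refine (abs_add_le _ _).trans ?_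
            rw [abs_mul, abs_mul, abs_of_pos ha0, abs_of_pos hb0]
        _ ≤ a * |s - t| + b * |s - t| := by gcongr
        _ = _ := by ring
    rw [Real.coe_toNNReal _ (by positivity), Real.dist_eq, Real.dist_eq]
    calc |dy s - dy t| = π * |cos (π * φ s) - cos (π * φ t)| := by
          rw [hdy, ← mul_sub, abs_mul, abs_of_pos pi_pos]
      _ ≤ π * |π * φ s - π * φ t| := by 
          exact mul_le_mul_of_nonneg_left (abs_cos_sub_cos_le _ _) pi_pos.le
      _ = π * (π * |φ s - φ t|) := by rw [← mul_sub, abs_mul, abs_of_pos pi_pos]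
      _ ≤ π * (π * ((a + b) * |s - t|)) := by gcongr
      _ = _ := by ring
  have hdyd : ∀ x, x ≠ T → HasDerivAt dy (q x * y x) x := by
    intro x hx
    rcases hx.lt_or_gt with h | h
    · refine (((hlin₁ x).cos.const_mul π).congr_of_eventuallyEq ?_).congr_deriv ?_
      · filter_upwards [Iio_mem_nhds h] with t ht
        simp only [hdy, hφl t (le_of_lt ht)]
      · simp only [hq, hy, if_pos h.le, hy₁]
        field_simp
    · refine (((hlin₂ x).cos.const_mul π).congr_of_eventuallyEq ?_).congr_deriv ?_
      · filter_upwards [Ioi_mem_nhds h] with t ht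
        simp only [hdy, hφr t (le_of_lt ht)]
      · simp only [hq, hy, if_neg (not_le.2 h), hy₂]
        field_simp
  have hqm : MemLp q p unitVolume := by
    refine MemLp.of_bound (Measurable.ite measurableSet_Iic measurable_const
      measurable_const).aestronglyMeasurable (max ((π * a) ^ 2) ((π * b) ^ 2))
      (Eventually.of_forall fun x => ?_)
    simp only [hq]
    split_ifs <;> rw [norm_neg, norm_pow, Real.norm_eq_abs, sq_abs]
    exacts [le_max_left _ _, le_max_right _ _]
  have hqi : Integrable q unitVolume := hqm.integrable hp_one
  have heig : IsDirichletEigenfunction q 0 y := by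
    refine ⟨?_, ?_, ?_, dy, fun x _ => (hyd x).hasDerivWithinAt, hac, fun x => q x * y x, ?_⟩
    · rw [hy0, hφ0, zero_mul, sin_zero]
    · rw [hy0, hφ1, sin_nat_mul_pi]
    · by_contra! hz
      have h0 : (0 : ℝ) ∈ Icc (0 : ℝ) 1 := by simp
      have h4 := (uniqueDiffOn_Icc zero_lt_one 0 h0).eq_deriv _
        ((hasDerivWithinAt_const (0 : ℝ) (Icc (0 : ℝ) 1) (0 : ℝ)).congr hz (hz 0 h0))
        (hyd 0).hasDerivWithinAt
      simp only [hdy, hφ0, mul_zero, cos_zero, mul_one] at h4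
      exact pi_ne_zero h4.symm
    · have hne : ∀ᵐ x ∂unitVolume, x ≠ T := ae_restrict_of_ae (Measure.ae_ne volume T)
      filter_upwards [hne] with x hx
      exact ⟨hdyd x hx, by ring⟩
  obtain ⟨θ, hθ⟩ := exists_isPruferAngle (continuous_primitive hqi).continuousOn 0
  have hval : ∀ {x : ℝ}, x ∈ Ioc (0 : ℝ) 1 → ∀ {n : ℕ}, φ x = n → θ x = n * π :=
    fun hx n hn => heig.isPruferAngle_eq hqi hθ (g := fun x => φ x * π) (by fun_prop)
      (fun s _ t _ hst => mul_lt_mul_of_pos_right (hφm hst) pi_pos) (by simp [hφ0])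
      (fun x _ => hy0 x) hx (by simp [hn])
  refine ⟨hqm.toLp q, ?_⟩
  have hLi : Integrable (hqm.toLp q) unitVolume := hqi.congr hqm.coeFn_toLp.symm
  refine (isNode_iff hLi hT).2 ⟨0, θ, ?_, hval (by simp) hφ1, hval ⟨hT.1, hT.2.le⟩ hφT⟩
  rwa [primitive_congr_ae hqm.coeFn_toLp]

/-! ### Closedness of the constraint and the minimizer. -/

/-- The admissible set is closed under convergence of the primitives, for bounded potentials. -/
theorem isNode_of_tendstoUniformlyOn {i m : ℕ} (hm : 1 ≤ m) {T M : ℝ} (hT : T ∈ Ioo (0 : ℝ) 1)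
    {qn : ℕ → ℝ → ℝ} {q : ℝ → ℝ} (hqn : ∀ n, Integrable (qn n) unitVolume)
    (hq : Integrable q unitVolume) (hM : ∀ n, ∀ x ∈ Icc (0 : ℝ) 1, |primitive (qn n) x| ≤ M)
    (hu : TendstoUniformlyOn (fun n => primitive (qn n)) (primitive q) atTop (Icc 0 1))
    (hn : ∀ n, IsNode (qn n) i m T) : IsNode q i m T := by
  choose μ θ hθ h1 hi using fun n => (isNode_iff (hqn n) hT).1 (hn n)
  obtain ⟨K, hK⟩ := exists_bound_of_isPruferAngle_le M (m * π)
  -- Too low an eigenvalue would leave the terminal angle below `π ≤ m π`; the upper bound is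
  -- `exists_bound_of_isPruferAngle_le`.
  have hμ : ∀ n, μ n ∈ Icc (-(2 * M ^ 2 + 3)) K := by
    refine fun n => ⟨?_, hK _ _ _ (hM n) (hθ n) (h1 n).le⟩
    by_contra! hlt
    have h2 := (hθ n).lt_pi (hM n) hlt.le
    rw [h1 n] at h2
    have : (1 : ℝ) ≤ m := by exact_mod_cast hm
    nlinarith [pi_pos]
  obtain ⟨ν, -, ψ, hψ, hν⟩ := isCompact_Icc.tendsto_subseq hμ
  have hF := (continuous_primitive hq).continuousOn (s := Icc (0 : ℝ) 1)
  obtain ⟨Θ, hΘ⟩ := exists_isPruferAngle hF ν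
  have hlim : ∀ {x : ℝ}, x ∈ Icc (0 : ℝ) 1 → ∀ {c : ℝ}, (∀ n, θ n x = c) → Θ x = c := by
    intro x hx c hc
    refine tendsto_nhds_unique (tendsto_isPruferAngle hF
      (fun s hs => hψ.tendsto_atTop.eventually (hu s hs)) hν (fun n => hθ (ψ n)) hΘ hx) ?_
    simp only [hc, tendsto_const_nhds]
  exact (isNode_iff hq hT).2 ⟨ν, Θ, hΘ, hlim (by simp) h1, hlim (Ioo_subset_Icc_self hT) hi⟩

end SturmLiouville

end

theorem mainTheorem1 (p : ℝ≥0∞) (hp_one : 1 < p) (hp_top : p < ∞)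
    (i m : ℕ) (hi : 1 ≤ i) (him : i < m)
    (T : ℝ) (hT : T ∈ Set.Ioo (0 : ℝ) 1) (q₀ : SturmLiouville.LpUnit p) :
    ∃ q' ∈ SturmLiouville.admissiblePotentials p i m T,
      ∀ q ∈ SturmLiouville.admissiblePotentials p i m T, ‖q' - q₀‖ ≤ ‖q - q₀‖ := by
  open SturmLiouville Filter Topology in
  have : Fact (1 ≤ p) := ⟨hp_one.le⟩
  set A : Set ℝ := (fun q => ‖q - q₀‖) '' admissiblePotentials p i m T with hA
  have hne : A.Nonempty := (admissiblePotentials_nonempty p hp_one.le hi him hT).image _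
  have hbdd : BddBelow A := ⟨0, by rintro _ ⟨q, -, rfl⟩; exact norm_nonneg _⟩
  obtain ⟨u, -, hu, huA⟩ := exists_seq_tendsto_sInf hne hbdd
  choose Q hQ hQu using huA
  obtain ⟨R, hR⟩ := hu.bddAbove_range
  have hnorm : ∀ n, eLpNorm (Q n - q₀ : LpUnit p) p unitVolume = ENNReal.ofReal (u n) := fun n => by
    rw [← hQu n, ofReal_norm, Lp.enorm_def]
  have hint : ∀ f : LpUnit p, Integrable f unitVolume := fun f => (Lp.memLp f).integrable hp_one.le
  -- Compactness is applied to the differences `Q n - q₀`, since lower semicontinuity is needed for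
  -- the distance to `q₀`.
  obtain ⟨g, φ, hφ, hg, hgu, hgD⟩ := exists_tendstoUniformlyOn_primitive hp_one hp_top
    (gn := fun n => (Q n - q₀ : LpUnit p)) (C := ENNReal.ofReal R) ENNReal.ofReal_ne_top
    (fun n => Lp.stronglyMeasurable _)
    (fun n => by rw [hnorm]; exact ENNReal.ofReal_le_ofReal (hR ⟨n, rfl⟩))
  have hprim : ∀ f : LpUnit p, primitive (f + q₀ : LpUnit p) = primitive f + primitive q₀ :=
    fun f => by rw [primitive_congr_ae (Lp.coeFn_add f q₀), primitive_add (hint f) (hint q₀)]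
  have hprimQ : ∀ n, primitive (Q n) = primitive (Q n - q₀ : LpUnit p) + primitive q₀ := fun n => by
    rw [← hprim, sub_add_cancel]
  refine ⟨hg.toLp g + q₀, ?_, fun q hq => ?_⟩
  · refine isNode_of_tendstoUniformlyOn (M := R + ‖q₀‖) (hi.trans him.le) hT
      (fun n => hint (Q (φ n))) (hint _) (fun n x hx => ?_) ?_ fun n => hQ (φ n)
    · have hn : ‖Q (φ n)‖ ≤ R + ‖q₀‖ := by
        have h1 : ‖Q (φ n) - q₀‖ ≤ R := (hQu (φ n)).trans_le (hR ⟨_, rfl⟩)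
        linarith [norm_le_norm_sub_add (Q (φ n)) q₀]
      refine (norm_primitive_le hp_one.le (Lp.memLp (Q (φ n))) (Lp.eLpNorm_ne_top _) le_rfl
        hx).trans ?_
      rwa [← Lp.norm_def]
    · rw [hprim, primitive_congr_ae hg.coeFn_toLp]
      simp_rw [hprimQ]
      intro V hV
      obtain ⟨ε, hε, hεV⟩ := Metric.mem_uniformity_dist.1 hV
      filter_upwards [Metric.tendstoUniformlyOn_iff.1 hgu ε hε] with n hn x hx
      exact hεV (by simpa using hn x hx)
  · rw [add_sub_cancel_right, Lp.norm_toLp]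
    have hd : sInf A ≤ ‖q - q₀‖ := csInf_le hbdd ⟨q, hq, rfl⟩
    -- The distances of the minimizing sequence are eventually below `‖q - q₀‖ + ε`, a bound that
    -- `g` inherits.
    refine le_of_forall_pos_le_add fun ε hε => ?_
    refine ENNReal.toReal_le_of_le_ofReal (by positivity) (hgD _ ?_)
    filter_upwards [hu.eventually (gt_mem_nhds (show sInf A < ‖q - q₀‖ + ε by linarith))] with n hn
    rw [hnorm]
    exact ENNReal.ofReal_le_ofReal hn.le
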